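/- Let $\Omega\subset\mathbb R^2$ be an open set (in particular, any domain with Lipschitz boundary), and let $T>0$, $\mu>0$, $\tau_y\ge 0$. For matrices put $A:B=\sum_{i,j}A_{ij}B_{ij}$ and $|A|^2=A:A$, and for a vector field $v$ put $Dv=\frac12(\nabla v+\nabla v^t)$. Let $V=\{v\in H^1_0(\Omega;\mathbb R^2):\nabla\cdot v=0\}$ with the $H^1$ norm (equivalent to $\|\nabla v\|_{L^2}$ when $\Omega$ is bounded), where $H^1_0$ is the $H^1$-closure of $C_c^\infty(\Omega;\mathbb R^2)$; let $V'$ be its dual and $H=\{v\in L^2(\Omega;\mathbb R^2):\nabla\cdot v=0,\ v\cdot n|_{\partial\Omega}=0\}$, the conditions being understood weakly. Let $f\in L^2(0,T;V')$ and $u_0\in H$. A weak solution of the Navier–Stokes–Bingham problem with data $(f,u_0)$ and homogeneous Dirichlet condition is a pair $(u,\tau)$ with $u\in L^2(0,T;V)$, $\partial_t u\in L^2(0,T;V')$, $\tau\in L^2(\Omega\times(0,T);\mathbb R^{2\times 2})$, such that $u(0)=u_0$ (that is, $u(t)\to u_0$ in $L^2(\Omega)$ as $t\to0^+$, up to a null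 set of times; equivalently, the continuous representative of $u$ with values in $L^2(\Omega)$ equals $u_0$ at $t=0$); almost everywhere in $\Omega\times(0,T)$, $$\tau=\Bigl(2\mu+\frac{\tau_y}{|Du|}\Bigr)Du\ \text{ if } Du\ne0,\qquad |\tau|\le\tau_y\ \text{ if } Du=0;$$ and for all $\varphi\in L^2(0,T;V)$ $$\int_0^T\langle\partial_tu,\varphi\rangle\,dt+\int_0^T\!\!\int_\Omega\tau:D\varphi\,dx\,dt+\int_0^T\!\!\int_\Omega(u\cdot\nabla)u\cdot\varphi\,dx\,dt=\int_0^T\langle f,\varphi\rangle\,dt .$$ Then the weak solution is unique: if $(u_1,\tau_1)$ and $(u_2,\tau_2)$ are weak solutions with the same data $f,u_0$ and the same $\mu,\tau_y$, then $u_1(t)=u_2(t)$ for almost every $t\in(0,T)$; consequently $\tau_1=\tau_2$ almost everywhere on $\{Du_1\neq0\}$. -/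

import Mathlib

open MeasureTheory Set Filter Topology
open scoped ContDiff

noncomputable section

namespace Bingham

/-- The plane with its Euclidean norm. -/
abbrev Plane : Type := EuclideanSpace ℝ (Fin 2)

/-- Real `2 × 2` matrices; the entry `A_ij` is `A (i, j)`, the inner product is
`A : B = ∑ A_ij B_ij` and the norm is `|A| = (A : A)^(1/2)`. -/
abbrev Mat2 : Type := EuclideanSpace ℝ (Fin 2 × Fin 2)

/-- `L²(Ω; ℝ²)`. -/
abbrev L2Vec (Ω : Set Plane) : Type := Lp Plane 2 (volume.restrict Ω)

/-- `L²(Ω; ℝ^{2×2})`. -/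
abbrev L2Mat (Ω : Set Plane) : Type := Lp Mat2 2 (volume.restrict Ω)

/-- The Hilbert space `L²(Ω; ℝ²) × L²(Ω; ℝ^{2×2})`, in which an `H¹` field `v` is represented by
the pair `(v, ∇v)`; the norm of that pair is the `H¹` norm of `v`. -/
abbrev Graph (Ω : Set Plane) : Type := WithLp 2 (L2Vec Ω × L2Mat Ω)

/-- The matrix `(∇v)_ij = ∂_j v_i` of a differentiable vector field. -/
def grad (v : Plane → Plane) (x : Plane) : Mat2 :=
  WithLp.toLp 2 fun p => fderiv ℝ v x (EuclideanSpace.single p.2 1) p.1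

/-- The symmetric part `(A + Aᵗ) / 2`. -/
def symPart (A : Mat2) : Mat2 := WithLp.toLp 2 fun p => (A (p.1, p.2) + A (p.2, p.1)) / 2

/-- `v ∈ C_c^∞(Ω; ℝ²)`. -/
def IsTestField (Ω : Set Plane) (v : Plane → Plane) : Prop :=
  ContDiff ℝ ∞ v ∧ HasCompactSupport v ∧ tsupport v ⊆ Ω

/-- The pairs `(v, ∇v)` with `v ∈ C_c^∞(Ω; ℝ²)`. -/
def testGraph (Ω : Set Plane) : Submodule ℝ (Graph Ω) where
  carrier := {w | ∃ v : Plane → Plane, IsTestField Ω v ∧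
    w.fst =ᵐ[volume.restrict Ω] v ∧ w.snd =ᵐ[volume.restrict Ω] grad v}
  zero_mem' := by
    refine ⟨0, ⟨contDiff_const, HasCompactSupport.zero, by simp [tsupport]⟩, ?_, ?_⟩
    · exact Lp.coeFn_zero _ _ _
    · filter_upwards [Lp.coeFn_zero Mat2 2 (volume.restrict Ω)] with x hx
      simp only [WithLp.zero_snd, hx]
      ext p
      simp [grad]
  add_mem' := by
    rintro a b ⟨v, ⟨hv1, hv2, hv3⟩, hav, hag⟩ ⟨w, ⟨hw1, hw2, hw3⟩, hbw, hbg⟩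
    refine ⟨v + w, ⟨hv1.add hw1, hv2.add hw2,
      (tsupport_add v w).trans (union_subset hv3 hw3)⟩, ?_, ?_⟩
    · filter_upwards [Lp.coeFn_add a.fst b.fst, hav, hbw] with x h1 h2 h3
      simp only [WithLp.add_fst, h1, Pi.add_apply, h2, h3]
    · filter_upwards [Lp.coeFn_add a.snd b.snd, hag, hbg] with x h1 h2 h3
      simp only [WithLp.add_snd, h1, Pi.add_apply, h2, h3]
      ext p
      simp [grad, fderiv_add ((hv1.differentiable (by simp)) x)
        ((hw1.differentiable (by simp)) x)]
  smul_mem' := by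
    rintro c a ⟨v, ⟨hv1, hv2, hv3⟩, hav, hag⟩
    refine ⟨c • v, ⟨hv1.const_smul c, hv2.smul_left (f := fun _ => c),
      (tsupport_smul_subset_right (fun _ => c) v).trans hv3⟩, ?_, ?_⟩
    · filter_upwards [Lp.coeFn_smul c a.fst, hav] with x h1 h2
      simp [h1, h2]
    · filter_upwards [Lp.coeFn_smul c a.snd, hag] with x h1 h2
      simp only [WithLp.smul_snd, h1, Pi.smul_apply, h2]
      ext p
      simp [grad, fderiv_const_smul ((hv1.differentiable (by simp)) x)]

/-- `H¹₀(Ω; ℝ²)`: the closure of `C_c^∞(Ω; ℝ²)` in the `H¹` norm. -/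
def H10 (Ω : Set Plane) : Submodule ℝ (Graph Ω) := (testGraph Ω).topologicalClosure

/-- `V = {v ∈ H¹₀(Ω; ℝ²) : ∇ · v = 0}`. -/
def V (Ω : Set Plane) : Submodule ℝ (Graph Ω) where
  carrier := {w | w ∈ H10 Ω ∧ ∀ᵐ x ∂(volume.restrict Ω), ∑ i, w.snd x (i, i) = 0}
  zero_mem' := by
    refine ⟨zero_mem _, ?_⟩
    filter_upwards [Lp.coeFn_zero Mat2 2 (volume.restrict Ω)] with x hx
    simp only [WithLp.zero_snd, hx]
    simp
  add_mem' := by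
    rintro a b ⟨ha, ha'⟩ ⟨hb, hb'⟩
    refine ⟨add_mem ha hb, ?_⟩
    filter_upwards [Lp.coeFn_add a.snd b.snd, ha', hb'] with x h1 h2 h3
    simp only [WithLp.add_snd, h1, Pi.add_apply, PiLp.add_apply, Finset.sum_add_distrib, h2, h3,
      add_zero]
  smul_mem' := by
    rintro c a ⟨ha, ha'⟩
    refine ⟨Submodule.smul_mem _ c ha, ?_⟩
    filter_upwards [Lp.coeFn_smul c a.snd, ha'] with x h1 h2
    simp only [WithLp.smul_snd, h1, Pi.smul_apply, PiLp.smul_apply, smul_eq_mul,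
      ← Finset.mul_sum, h2, mul_zero]

/-- The field `v ∈ L²(Ω; ℝ²)` underlying an element of `V`. -/
def field {Ω : Set Plane} (w : V Ω) : L2Vec Ω := (w : Graph Ω).fst

/-- The weak gradient `∇v ∈ L²(Ω; ℝ^{2×2})` of an element of `V`. -/
def weakGrad {Ω : Set Plane} (w : V Ω) : L2Mat Ω := (w : Graph Ω).snd

/-- The strain tensor `Dv = (∇v + ∇vᵗ) / 2` of an element of `V`. -/
def strain {Ω : Set Plane} (w : V Ω) (x : Plane) : Mat2 := symPart (weakGrad w x)

/-- `H = {v ∈ L²(Ω; ℝ²) : ∇ · v = 0, v · n = 0 on ∂Ω}`, where both conditions are understood in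
the usual weak sense `∫_Ω v · ∇q = 0` for all smooth `q` (not required to vanish on `∂Ω`). -/
def H (Ω : Set Plane) : Submodule ℝ (L2Vec Ω) where
  carrier := {v | ∀ q : Plane → ℝ, ContDiff ℝ ∞ q → HasCompactSupport q →
    ∫ x in Ω, fderiv ℝ q x (v x) = 0}
  zero_mem' := by
    intro q _ _
    rw [integral_congr_ae (g := fun _ => (0 : ℝ))]
    · simp
    · filter_upwards [Lp.coeFn_zero Plane 2 (volume.restrict Ω)] with x hx
      simp only [hx]
      simp
  add_mem' := by
    intro a b ha hb q hq hc
    have key : ∀ v : L2Vec Ω, Integrable (fun x => fderiv ℝ q x (v x)) (volume.restrict Ω) := by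
      intro v
      have h1 : MemLp (fderiv ℝ q) 2 (volume.restrict Ω) :=
        ((hq.continuous_fderiv (by simp)).memLp_of_hasCompactSupport (hc.fderiv ℝ))
      refine ((Lp.memLp v).norm.integrable_mul h1.norm).mono'
        ?_ (Eventually.of_forall fun x => ?_)
      · exact (ContinuousLinearMap.apply ℝ ℝ).flip.aestronglyMeasurable_comp₂
          h1.aestronglyMeasurable (Lp.aestronglyMeasurable v)
      · simpa [mul_comm] using (fderiv ℝ q x).le_opNorm (v x)
    rw [integral_congr_ae (g := fun x => fderiv ℝ q x (a x) + fderiv ℝ q x (b x)),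
      integral_add (key a) (key b), ha q hq hc, hb q hq hc, add_zero]
    filter_upwards [Lp.coeFn_add a b] with x hx
    simp only [hx]
    simp
  smul_mem' := by
    intro c a ha q hq hc
    rw [integral_congr_ae (g := fun x => c * fderiv ℝ q x (a x)), integral_const_mul,
      ha q hq hc, mul_zero]
    filter_upwards [Lp.coeFn_smul c a] with x hx
    simp only [hx]
    simp

/-- The dual space `V'`. -/
abbrev VDual (Ω : Set Plane) : Type := StrongDual ℝ (V Ω)

/-- Lebesgue measure on the time interval `(0, T)`. -/
abbrev timeMeasure (T : ℝ) : Measure ℝ := volume.restrict (Ioo 0 T)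

/-- `g = ∂ₜu` in the sense of `V'`-valued distributions on `(0, T)`, where `V ⊆ L² ⊆ V'` through
the `L²` inner product. -/
def HasWeakTimeDeriv {Ω : Set Plane} (T : ℝ) (u : ℝ → V Ω) (g : ℝ → VDual Ω) : Prop :=
  ∀ ψ : ℝ → ℝ, ContDiff ℝ ∞ ψ → HasCompactSupport ψ → tsupport ψ ⊆ Ioo 0 T → ∀ v : V Ω,
    ∫ t in Ioo 0 T, deriv ψ t * inner ℝ (field (u t)) (field v) =
      -∫ t in Ioo 0 T, ψ t * g t v

/-- The Bingham law with viscosity `μ` and yield stress `τy`: the stress `S` is admissible for the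
strain `D`. -/
def BinghamLaw (μ τy : ℝ) (D S : Mat2) : Prop :=
  (D ≠ 0 → S = (2 * μ + τy / ‖D‖) • D) ∧ (D = 0 → ‖S‖ ≤ τy)

/-- `∫_Ω (u · ∇)v · w`, with `((u · ∇)v)_i = ∑_j u_j ∂_j v_i`. -/
def convection {Ω : Set Plane} (u v w : V Ω) : ℝ :=
  ∫ x in Ω, ∑ i, (∑ j, field u x j * weakGrad v x (i, j)) * field w x i

/-- `(u, τ)` is a weak solution, on `Ω × (0, T)`, of the Navier–Stokes–Bingham problem with force
`f`, initial velocity `u₀` and homogeneous Dirichlet condition. Here `L²(Ω × (0, T))` is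
`L²(0, T; L²(Ω))` and integrals over `Ω × (0, T)` are iterated: for `φ ∈ L²(0, T; V)` the function
`(u · ∇)u · φ` need not be absolutely integrable on `Ω × (0, T)`, while its integral over `Ω`
exists for almost all times and is integrable in time. -/
structure IsWeakSolution (Ω : Set Plane) (T μ τy : ℝ) (f : ℝ → VDual Ω) (u₀ : H Ω)
    (u : ℝ → V Ω) (τ : ℝ → L2Mat Ω) : Prop where
  /-- `u ∈ L²(0, T; V)`. -/
  memLp_velocity : MemLp u 2 (timeMeasure T)
  /-- `τ ∈ L²(Ω × (0, T))`. -/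
  memLp_stress : MemLp τ 2 (timeMeasure T)
  /-- `τ` is a Bingham stress for `Du`, almost everywhere. -/
  law : ∀ᵐ t ∂(timeMeasure T), ∀ᵐ x ∂(volume.restrict Ω),
    BinghamLaw μ τy (strain (u t) x) (τ t x)
  /-- `∂ₜu ∈ L²(0, T; V')`, and the weak formulation holds for all `φ ∈ L²(0, T; V)`. -/
  weak_form : ∃ g : ℝ → VDual Ω, MemLp g 2 (timeMeasure T) ∧ HasWeakTimeDeriv T u g ∧
    ∀ φ : ℝ → V Ω, MemLp φ 2 (timeMeasure T) →
      (∫ t in Ioo 0 T, g t (φ t))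
        + (∫ t in Ioo 0 T, ∫ x in Ω, inner ℝ (τ t x) (strain (φ t) x))
        + (∫ t in Ioo 0 T, convection (u t) (u t) (φ t))
        = ∫ t in Ioo 0 T, f t (φ t)
  /-- `u(0) = u₀`: the velocity `u(t)` tends to `u₀` in `L²(Ω)` as `t → 0+`, times in a null set
  being disregarded; equivalently, the representative of `u` that is continuous from `[0, T]` into
  `L²(Ω)` has the value `u₀` at `0`. -/
  initial : Tendsto (fun t => field (u t)) (𝓝[>] (0 : ℝ) ⊓ ae volume) (𝓝 (u₀ : L2Vec Ω))

end Bingham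

end

/-! Put `w = u₁ - u₂` and test the difference of the two equations with `w`: `½ d/dt ‖w‖² + ∫ (τ₁ -
τ₂) : Dw + ∫ (w · ∇)u₁ · w = 0`.

The stress term is coercive. A Bingham stress is `2μD` plus a subgradient of `τy |·|` at `D`, and
subgradients are monotone (`BinghamLaw.le_inner_sub`), so the term is at least `2μ ‖Dw‖²`. Korn's
inequality `‖∇w‖² ≤ 2 ‖Dw‖²` (`norm_snd_sq_le_symPartLp`) turns this into `μ ‖∇w‖²`.

In the convective term the contribution `∫ (u₂ · ∇)w · w` has disappeared because `u₂` is divergence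
free (`conv_self_eq_zero`). The rest is at most `K ‖w‖ ‖∇w‖ ‖∇u₁‖` by Hölder and the planar
Ladyzhenskaya inequality (`eLpNorm_four_sq_le`). Young's inequality then gives `d/dt ‖w‖² + μ ‖∇w‖²
≤ (K² / μ) ‖∇u₁‖² ‖w‖²`, and `‖∇u₁‖²` is integrable in time, so Grönwall with `w(0) = 0` forces `w =
0`. Korn and Ladyzhenskaya hold here with constants independent of `Ω`, and no Poincaré inequality
enters.

Two points need care in time. The equation is first localized to almost every time (`weak_form_ae`),
where pairing with `w` is legitimate. The identity `d/dt ‖w‖² = 2⟨∂ₜw, w⟩`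
(`ae_norm_sq_sub_integral_eq_const`) comes from increments instead of mollification: `‖w(t)‖² -
‖w(s)‖² = ⟨∫ₛᵗ g, w(t) + w(s)⟩` for almost all `s`, `t`, and replacing `w(t) + w(s)` by `2w(r)`
under the integral costs only `o(t - s)` in the mean, because translation is continuous in `L²`. No
continuous representative of the velocity is constructed; the initial condition is used as a limit
along times outside null sets. -/

noncomputable section

namespace Bingham

/-! ### Weak derivatives and primitives on an interval -/

/-- A smooth function with compact support in `(0, T)` and mean zero is the derivative of such a
function. -/
theorem exists_deriv_eq_of_integral_eq_zero {T : ℝ} {h : ℝ → ℝ} (hh : ContDiff ℝ ∞ h)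
    (hc : HasCompactSupport h) (hs : tsupport h ⊆ Ioo 0 T) (h0 : ∫ x, h x = 0) :
    ∃ ψ : ℝ → ℝ, ContDiff ℝ ∞ ψ ∧ HasCompactSupport ψ ∧ tsupport ψ ⊆ Ioo 0 T ∧ deriv ψ = h := by
  rcases (tsupport h).eq_empty_or_nonempty with he | hne
  · have : h = 0 := tsupport_eq_empty_iff.mp he
    exact ⟨0, contDiff_const, HasCompactSupport.zero, by simp [tsupport], by simp [this]⟩
  obtain ⟨a, ha⟩ := hc.isCompact.exists_isLeast hne
  obtain ⟨b, hb⟩ := hc.isCompact.exists_isGreatest hne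
  have hz : ∀ x, x ∉ Icc a b → h x = 0 := fun x hx => image_eq_zero_of_notMem_tsupport
    fun hx' => hx ⟨ha.2 hx', hb.2 hx'⟩
  have hd : ∀ x, HasDerivAt (fun y => ∫ s in a..y, h s) (h x) x := fun x =>
    (hh.continuous.integral_hasStrictDerivAt a x).hasDerivAt
  have hdd : deriv (fun y => ∫ s in a..y, h s) = h := funext fun x => (hd x).deriv
  have hout : ∀ x, x ∉ Icc a b → ∫ s in a..x, h s = 0 := by
    intro x hx
    rcases lt_or_ge x a with hxa | hxa
    · rw [intervalIntegral.integral_symm, intervalIntegral.integral_of_le hxa.le,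
        integral_Ioc_eq_integral_Ioo, setIntegral_eq_zero_of_forall_eq_zero, neg_zero]
      exact fun y hy => hz y fun h' => not_lt.2 h'.1 hy.2
    · have hxb : b < x := by
        by_contra! h'
        exact hx ⟨hxa, h'⟩
      rw [intervalIntegral.integral_of_le hxa, ← integral_Icc_eq_integral_Ioc,
        setIntegral_eq_integral_of_forall_compl_eq_zero, h0]
      exact fun y hy => hz y fun h' => hy ⟨h'.1, h'.2.trans hxb.le⟩
  have hts : tsupport (fun y => ∫ s in a..y, h s) ⊆ Icc a b :=
    closure_minimal (fun x hx => by
      by_contra h'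
      exact hx (hout x h')) isClosed_Icc
  refine ⟨_, ?_, HasCompactSupport.of_support_subset_isCompact isCompact_Icc
    ((subset_tsupport _).trans hts), hts.trans (Icc_subset_Ioo (hs ha.1).1 (hs hb.1).2), hdd⟩
  rw [contDiff_infty_iff_deriv, hdd]
  exact ⟨fun x => (hd x).differentiableAt, hh⟩

/-- A function on `(0, T)` with vanishing weak derivative is constant. -/
theorem ae_eq_const_of_integral_deriv_mul_eq_zero {T : ℝ} (hT : 0 < T) {z : ℝ → ℝ}
    (hz : IntegrableOn z (Ioo 0 T))
    (h : ∀ ψ : ℝ → ℝ, ContDiff ℝ ∞ ψ → HasCompactSupport ψ → tsupport ψ ⊆ Ioo 0 T →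
      ∫ t in Ioo 0 T, deriv ψ t * z t = 0) :
    ∃ c, ∀ᵐ t ∂volume.restrict (Ioo 0 T), z t = c := by
  -- The outer radius `T / 4` keeps the support inside `[T / 4, 3T / 4]`. The normalized bump `η`
  -- has integral one, and the constant sought is `∫ η z`.
  let b : ContDiffBump (T / 2) := ⟨T / 8, T / 4, by positivity, by linarith⟩
  set η : ℝ → ℝ := b.normed volume with hη
  have hη1 : ContDiff ℝ ∞ η := b.contDiff_normed
  have hη2 : HasCompactSupport η := b.hasCompactSupport_normed
  have hη3 : tsupport η ⊆ Ioo 0 T := by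
    rw [hη, b.tsupport_normed_eq]
    intro x hx
    rw [Metric.mem_closedBall, Real.dist_eq, abs_le] at hx
    have : b.rOut = T / 4 := rfl
    constructor <;> linarith [hx.1, hx.2]
  have hint : ∀ θ : ℝ → ℝ, ContDiff ℝ ∞ θ → HasCompactSupport θ →
      Integrable (fun t => θ t * z t) (volume.restrict (Ioo 0 T)) := by
    intro θ h1 h2
    obtain ⟨C, hC⟩ := h1.continuous.bounded_above_of_compact_support h2
    exact hz.bdd_mul h1.continuous.aestronglyMeasurable (Eventually.of_forall hC)
  set c := ∫ t in Ioo 0 T, η t * z t with hc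
  refine ⟨c, ?_⟩
  have key : ∀ᵐ x ∂(volume : Measure ℝ), x ∈ Ioo 0 T → z x - c = 0 := by
    refine isOpen_Ioo.ae_eq_zero_of_integral_contDiff_smul_eq_zero ?_ ?_
    · exact (hz.sub (integrableOn_const (by simp))).locallyIntegrableOn
    · intro θ h1 h2 h3
      have hθi : Integrable θ := h1.continuous.integrable_of_hasCompactSupport h2
      set m := ∫ t, θ t with hm
      -- Subtracting `m • η` removes the mean of `θ`, so the difference is an admissible `ψ'`.
      obtain ⟨ψ, p1, p2, p3, p4⟩ := exists_deriv_eq_of_integral_eq_zero (T := T)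
        (h := θ - m • η) (h1.sub (hη1.const_smul m)) (h2.sub (hη2.smul_left (f := fun _ => m)))
        ((tsupport_sub _ _).trans (union_subset h3
          ((tsupport_smul_subset_right (fun _ => m) η).trans hη3)))
        (by
          simp only [Pi.sub_apply, Pi.smul_apply, smul_eq_mul]
          rw [integral_sub hθi ((hη1.continuous.integrable_of_hasCompactSupport hη2).const_mul _),
            integral_const_mul, hη, b.integral_normed]
          simp [hm])
      have := h ψ p1 p2 p3
      rw [p4] at this
      simp only [Pi.sub_apply, Pi.smul_apply, smul_eq_mul, sub_mul, mul_assoc] at this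
      rw [integral_sub (hint θ h1 h2) ((hint η hη1 hη2).const_mul m), integral_const_mul] at this
      have e : ∫ x, θ x • (z x - c) = ∫ x in Ioo 0 T, (θ x * z x - θ x * c) := by
        rw [setIntegral_eq_integral_of_forall_compl_eq_zero]
        · simp [mul_sub]
        · intro x hx
          simp [image_eq_zero_of_notMem_tsupport fun h' => hx (h3 h')]
      have e2 : ∫ x in Ioo 0 T, θ x = m :=
        setIntegral_eq_integral_of_forall_compl_eq_zero fun x hx =>
          image_eq_zero_of_notMem_tsupport fun h' => hx (h3 h')
      rw [e, integral_sub (hint θ h1 h2) (hθi.restrict.mul_const _), integral_mul_const, e2]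
      exact this
  rw [ae_restrict_iff' measurableSet_Ioo]
  filter_upwards [key] with x hx hx'
  linarith [hx hx']

theorem intervalIntegrable_of_integrableOn_Ioo {E : Type*} [NormedAddCommGroup E] {T : ℝ}
    {k : ℝ → E} (hk : IntegrableOn k (Ioo 0 T)) {s t : ℝ} (hs : s ∈ Icc 0 T) (ht : t ∈ Icc 0 T) :
    IntervalIntegrable k volume s t := by
  rw [intervalIntegrable_iff]
  have h : IntegrableOn k (Icc 0 T) := by rwa [integrableOn_Icc_iff_integrableOn_Ioo]
  exact h.mono_set (uIoc_subset_uIcc.trans (uIcc_subset_Icc hs ht))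

theorem integrableOn_primitive {T : ℝ} (hT : 0 < T) {k : ℝ → ℝ} (hk : IntegrableOn k (Ioo 0 T)) :
    IntegrableOn (fun t => ∫ s in (0 : ℝ)..t, k s) (Ioo 0 T) := by
  have h := (intervalIntegral.continuousOn_primitive_interval'
    (intervalIntegrable_of_integrableOn_Ioo hk (left_mem_Icc.2 hT.le) (right_mem_Icc.2 hT.le))
    left_mem_uIcc).integrableOn_uIcc (μ := volume)
  rw [uIcc_of_le hT.le] at h
  exact h.mono_set Ioo_subset_Icc_self

/-- Integration by parts for the primitive of an integrable function. -/
theorem integral_deriv_mul_primitive {T : ℝ} (hT : 0 < T) {k : ℝ → ℝ}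
    (hk : IntegrableOn k (Ioo 0 T)) {ψ : ℝ → ℝ} (hψ : ContDiff ℝ ∞ ψ)
    (hs : tsupport ψ ⊆ Ioo 0 T) :
    ∫ t in Ioo 0 T, deriv ψ t * (∫ s in (0 : ℝ)..t, k s) = -∫ t in Ioo 0 T, ψ t * k t := by
  have hk' := intervalIntegrable_of_integrableOn_Ioo hk (left_mem_Icc.2 hT.le)
    (right_mem_Icc.2 hT.le)
  have h1 : AbsolutelyContinuousOnInterval ψ 0 T :=
    (hψ.of_le (by simp)).contDiffOn.absolutelyContinuousOnInterval
  have h2 := hk'.absolutelyContinuousOnInterval_intervalIntegral (c := 0) (by simp)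
  have h3 := h1.integral_mul_deriv_eq_deriv_mul h2
  have e0 : ψ T = 0 := image_eq_zero_of_notMem_tsupport fun h => lt_irrefl _ (hs h).2
  rw [e0, intervalIntegral.integral_same, zero_mul, mul_zero, sub_zero, zero_sub] at h3
  rw [← integral_Ioc_eq_integral_Ioo, ← integral_Ioc_eq_integral_Ioo,
    ← intervalIntegral.integral_of_le hT.le, ← intervalIntegral.integral_of_le hT.le,
    eq_neg_iff_add_eq_zero, add_comm, ← eq_neg_iff_add_eq_zero, ← h3]
  refine intervalIntegral.integral_congr_ae ?_
  filter_upwards [hk'.ae_hasDerivAt_integral] with x hx hx'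
  rw [(hx (uIoc_subset_uIcc hx') 0 left_mem_uIcc).deriv]

/-! ### Energy identity for a time derivative with values in the dual -/

section Increment

variable {E F : Type*} [NormedAddCommGroup E] [NormedSpace ℝ E] [NormedAddCommGroup F]
  [InnerProductSpace ℝ F]

/-- A function in `L²(0, T; E)` with weak time derivative `g` in `L²(0, T; E')` satisfies
`u(t) - u(s) = ∫ₛᵗ g` in `E'` for all times `s`, `t` outside of a null set. -/
theorem ae_inner_sub_eq_integral [SecondCountableTopology E] {T : ℝ} (hT : 0 < T) (j : E →L[ℝ] F)
    {u : ℝ → E} {g : ℝ → StrongDual ℝ E} (hu : IntegrableOn u (Ioo 0 T))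
    (hg : IntegrableOn g (Ioo 0 T))
    (hw : ∀ ψ : ℝ → ℝ, ContDiff ℝ ∞ ψ → HasCompactSupport ψ → tsupport ψ ⊆ Ioo 0 T → ∀ v : E,
      ∫ t in Ioo 0 T, deriv ψ t * inner ℝ (j (u t)) (j v) = -∫ t in Ioo 0 T, ψ t * g t v) :
    ∃ S : Set ℝ, S ⊆ Ioo 0 T ∧ (∀ᵐ t ∂volume.restrict (Ioo 0 T), t ∈ S) ∧
      ∀ s ∈ S, ∀ t ∈ S, ∀ v : E,
        inner ℝ (j (u t) - j (u s)) (j v) = (∫ r in s..t, g r) v := by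
  have h1 : ∀ v : E, ∃ c : ℝ, ∀ᵐ t ∂volume.restrict (Ioo 0 T),
      inner ℝ (j (u t)) (j v) - ∫ s in (0 : ℝ)..t, g s v = c := by
    intro v
    have hgv : IntegrableOn (fun t => g t v) (Ioo 0 T) :=
      (ContinuousLinearMap.apply ℝ ℝ v).integrable_comp hg
    have hjv : IntegrableOn (fun t => inner ℝ (j (u t)) (j v)) (Ioo 0 T) :=
      (j.integrable_comp hu).inner_const _
    refine ae_eq_const_of_integral_deriv_mul_eq_zero hT (hjv.sub (integrableOn_primitive hT hgv)) ?_
    intro ψ p1 p2 p3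
    obtain ⟨C, hC⟩ := (p1.continuous_deriv (by simp)).bounded_above_of_compact_support p2.deriv
    have hm : AEStronglyMeasurable (deriv ψ) (volume.restrict (Ioo 0 T)) :=
      (p1.continuous_deriv (by simp)).aestronglyMeasurable
    simp only [mul_sub]
    rw [integral_sub, hw ψ p1 p2 p3, integral_deriv_mul_primitive hT hgv p1 p3, sub_self]
    · exact hjv.bdd_mul hm (Eventually.of_forall hC)
    · exact (integrableOn_primitive hT hgv).bdd_mul hm (Eventually.of_forall hC)
  choose c hc using h1
  -- The exceptional null set depends on `v`. Restricting to countably many `v` gives one null set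
  -- for all of them, and density recovers every `v` because both sides are continuous in `v`.
  obtain ⟨D, hD1, hD2⟩ := TopologicalSpace.exists_countable_dense E
  refine ⟨{t | t ∈ Ioo 0 T ∧ ∀ v ∈ D, inner ℝ (j (u t)) (j v) - ∫ s in (0 : ℝ)..t, g s v = c v},
    fun t ht => ht.1, ?_, ?_⟩
  · filter_upwards [ae_restrict_mem measurableSet_Ioo, (ae_ball_iff hD1).2 fun v _ => hc v]
      with t h1 h2 using ⟨h1, h2⟩
  · rintro s ⟨hs1, hs2⟩ t ⟨ht1, ht2⟩
    have hI : ∀ r ∈ Icc 0 T, ∀ r' ∈ Icc 0 T, IntervalIntegrable g volume r r' :=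
      fun r hr r' hr' => intervalIntegrable_of_integrableOn_Ioo hg hr hr'
    have hs' := Ioo_subset_Icc_self hs1
    have ht' := Ioo_subset_Icc_self ht1
    have h0 : (0 : ℝ) ∈ Icc 0 T := left_mem_Icc.2 hT.le
    have := hD2.induction (P := fun v => inner ℝ (j (u t) - j (u s)) (j v) = (∫ r in s..t, g r) v)
      ?_ (isClosed_eq (by fun_prop) (by fun_prop))
    · exact this
    intro v hv
    have e1 := hs2 v hv
    have e2 := ht2 v hv
    rw [← ContinuousLinearMap.intervalIntegral_apply (hI _ h0 _ hs')] at e1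
    rw [← ContinuousLinearMap.intervalIntegral_apply (hI _ h0 _ ht')] at e2
    rw [← intervalIntegral.integral_interval_sub_left (hI _ h0 _ ht') (hI _ h0 _ hs'), inner_sub_left]
    simp only [sub_apply]
    linarith

end Increment

/-- Translation is continuous in `L²(ℝ; E)`. -/
theorem tendsto_eLpNorm_translate_sub {E : Type*} [NormedAddCommGroup E] {u : ℝ → E}
    (hu : MemLp u 2 volume) :
    Tendsto (fun h : ℝ => eLpNorm (fun r => u (r + h) - u r) 2 volume) (𝓝 0) (𝓝 0) := by
  have : Fact ((2 : ENNReal) ≠ ⊤) := ⟨by simp⟩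
  have h1 : Tendsto (fun h : ℝ => DomAddAct.mk h +ᵥ hu.toLp u) (𝓝 0) (𝓝 (hu.toLp u)) := by
    have : Continuous fun h : ℝ => DomAddAct.mk h +ᵥ hu.toLp u :=
      (DomAddAct.continuous_mk).vadd continuous_const
    convert this.tendsto 0
    simp
  rw [tendsto_iff_edist_tendsto_0] at h1
  refine h1.congr fun h => ?_
  rw [DomAddAct.mk_vadd_toLp, Lp.edist_toLp_toLp]
  congr 1
  ext r
  simp [add_comm]

/-- An integrable function whose increments over time `h` are `o(h)` in the mean has no weak
derivative besides zero. -/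
theorem integral_deriv_mul_eq_zero_of_isLittleO {z ψ : ℝ → ℝ} (hz : Integrable z)
    (hψ : ContDiff ℝ ∞ ψ) (hc : HasCompactSupport ψ)
    (h : ∀ ε > 0, ∀ᶠ δ in 𝓝[>] (0 : ℝ), |∫ r, ψ r * (z (r + δ) - z r)| ≤ ε * δ) :
    ∫ t, deriv ψ t * z t = 0 := by
  obtain ⟨C, hC⟩ := hψ.continuous.bounded_above_of_compact_support hc
  obtain ⟨K, hK⟩ :=
    (hψ.of_le (by simp : (1 : WithTop ℕ∞) ≤ ∞)).lipschitzWith_of_hasCompactSupport hc one_ne_zero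
  have hm : ∀ δ, AEStronglyMeasurable (fun r => ψ (r - δ)) volume := fun δ =>
    (hψ.continuous.comp (continuous_id.sub continuous_const)).aestronglyMeasurable
  have hi : ∀ δ, Integrable (fun r => ψ (r - δ) * z r) := fun δ =>
    hz.bdd_mul (hm δ) (Eventually.of_forall fun r => hC _)
  -- The translation is put on the smooth factor, so that `δ ↦ ∫ ψ(r - δ) z(r)` can be
  -- differentiated under the integral sign; its derivative at `0` is `-∫ ψ' z`.
  have hd := (hasDerivAt_integral_of_dominated_loc_of_lip (F := fun δ r => ψ (r - δ) * z r)
    (F' := fun r => -deriv ψ r * z r) (x₀ := (0 : ℝ)) (s := univ) (bound := fun r => K * |z r|) univ_mem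
    (Eventually.of_forall fun δ => (hi δ).aestronglyMeasurable) (hi 0)
    (((hψ.continuous_deriv (by simp)).neg.aestronglyMeasurable).mul hz.aestronglyMeasurable)
    (Eventually.of_forall fun r => by
      refine (LipschitzWith.of_dist_le_mul fun x y => ?_).lipschitzOnWith
      rw [Real.dist_eq, ← sub_mul, abs_mul, Real.coe_nnabs, abs_mul, abs_abs, NNReal.abs_eq]
      have := hK.dist_le_mul (r - x) (r - y)
      rw [dist_sub_left, Real.dist_eq] at this
      nlinarith [abs_nonneg (z r)])
    (hz.abs.const_mul _)
    (Eventually.of_forall fun r => by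
      have h1 : HasDerivAt ψ (deriv ψ r) (r - 0) := by
        rw [sub_zero]
        exact (hψ.differentiable (by simp) r).hasDerivAt
      have h2 := (h1.comp (0 : ℝ) ((hasDerivAt_id (0 : ℝ)).const_sub r)).mul_const (z r)
      simpa using! h2)).2
  have e : ∀ δ, (∫ r, ψ (r - δ) * z r) - ∫ r, ψ (r - 0) * z r = ∫ r, ψ r * (z (r + δ) - z r) := by
    intro δ
    rw [← integral_add_right_eq_self (fun r => ψ (r - δ) * z r) δ]
    simp only [add_sub_cancel_right, sub_zero, mul_sub]
    rw [integral_sub]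
    · simpa using (hi δ).comp_add_right δ
    · simpa using hi 0
  -- By the assumed `o(δ)` bound the same function has right derivative zero, and one-sided
  -- derivatives are unique.
  have h0 : HasDerivWithinAt (fun δ => ∫ r, ψ (r - δ) * z r) 0 (Ioi 0) 0 := by
    rw [hasDerivWithinAt_iff_isLittleO, Asymptotics.isLittleO_iff]
    intro ε hε
    filter_upwards [h ε hε, self_mem_nhdsWithin] with δ h1 h2
    rw [smul_zero, sub_zero, e, Real.norm_eq_abs, sub_zero, Real.norm_of_nonneg (le_of_lt h2)]
    exact h1
  have := (uniqueDiffWithinAt_Ioi (0 : ℝ)).eq_deriv _ hd.hasDerivWithinAt h0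
  simp only [neg_mul] at this
  rwa [integral_neg, neg_eq_zero] at this

section Increment

variable {E : Type*} [NormedAddCommGroup E] [NormedSpace ℝ E]

theorem integrable_apply {α : Type*} [MeasurableSpace α] {ν : Measure α} {g : α → StrongDual ℝ E}
    {u : α → E} (hg : MemLp g 2 ν) (hu : MemLp u 2 ν) : Integrable (fun t => g t (u t)) ν :=
  (hg.norm.integrable_mul hu.norm).mono'
    (ContinuousLinearMap.apply ℝ ℝ |>.flip.aestronglyMeasurable_comp₂ hg.1 hu.1)
    (Eventually.of_forall fun t => (g t).le_opNorm (u t))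

theorem lintegral_enorm_mul_le {E₁ E₂ : Type*} [NormedAddCommGroup E₁] [NormedAddCommGroup E₂]
    {α : Type*} [MeasurableSpace α] {ν : Measure α} {f : α → E₁} {g : α → E₂}
    (hf : AEStronglyMeasurable f ν) (hg : AEStronglyMeasurable g ν) :
    ∫⁻ x, ‖f x‖ₑ * ‖g x‖ₑ ∂ν ≤ eLpNorm f 2 ν * eLpNorm g 2 ν := by
  have := ENNReal.lintegral_mul_le_Lp_mul_Lq ν Real.HolderConjugate.two_two hf.enorm hg.enorm
  simpa [eLpNorm_eq_lintegral_rpow_enorm_toReal] using this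

/-- By Tonelli the integral in `r` is taken first, with `σ` fixed. Cauchy–Schwarz then separates `g`
from two increments of `u`, which are up to translation and sign the increments over `δ - σ` and
`σ`, both in `[0, δ]`. -/
theorem lintegral_increment_le {u : ℝ → E} {g : ℝ → StrongDual ℝ E} (hu : StronglyMeasurable u)
    (hg : StronglyMeasurable g) {δ : ℝ} {η : ENNReal}
    (hη : ∀ σ ∈ Icc 0 δ, eLpNorm (fun r => u (r + σ) - u r) 2 volume ≤ η) :
    ∫⁻ r, ∫⁻ σ in Ioc 0 δ, ‖g (r + σ)‖ₑ * (‖u (r + δ) - u (r + σ)‖ₑ + ‖u r - u (r + σ)‖ₑ) ≤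
      ENNReal.ofReal δ * (eLpNorm g 2 volume * (2 * η)) := by
  have m : ∀ c : ℝ, StronglyMeasurable (fun r => u (r + c)) := fun c =>
    hu.comp_measurable (measurable_id.add_const c)
  have mg : ∀ c : ℝ, StronglyMeasurable (fun r => g (r + c)) := fun c =>
    hg.comp_measurable (measurable_id.add_const c)
  rw [lintegral_lintegral_swap]
  · calc _ ≤ ∫⁻ σ in Ioc 0 δ, eLpNorm g 2 volume * (2 * η) := by
          refine setLIntegral_mono measurable_const fun σ hσ => ?_
          have tg : eLpNorm (fun r => g (r + σ)) 2 volume = eLpNorm g 2 volume :=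
            eLpNorm_comp_measurePreserving hg.aestronglyMeasurable
              (measurePreserving_add_right volume σ)
          simp only [mul_add]
          rw [lintegral_add_left (by
            exact ((mg σ).enorm.mul ((m δ).sub (m σ)).enorm)), two_mul, mul_add]
          refine add_le_add ?_ ?_
          · refine (lintegral_enorm_mul_le (mg σ).aestronglyMeasurable
              ((m δ).sub (m σ)).aestronglyMeasurable).trans ?_
            rw [tg]
            gcongr
            have : eLpNorm (fun r => u (r + (δ - σ)) - u r) 2 volume = _ :=
              (eLpNorm_comp_measurePreserving (μ := volume) ((m (δ - σ)).sub hu).aestronglyMeasurable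
              (measurePreserving_add_right volume σ)).symm
            refine le_trans (le_of_eq ?_) (hη (δ - σ) ⟨by linarith [hσ.2], by linarith [hσ.1]⟩)
            rw [this]
            congr 1
            ext r
            simp [add_assoc]
          · refine (lintegral_enorm_mul_le (mg σ).aestronglyMeasurable
              (hu.sub (m σ)).aestronglyMeasurable).trans ?_
            rw [tg]
            gcongr
            rw [eLpNorm_sub_comm]
            exact hη σ ⟨hσ.1.le, hσ.2⟩
      _ = _ := by
        rw [setLIntegral_const, Real.volume_Ioc, sub_zero, mul_comm]
  · refine Measurable.aemeasurable ?_
    have a1 : Measurable fun p : ℝ × ℝ => p.1 + p.2 := measurable_fst.add measurable_snd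
    have a2 : Measurable fun p : ℝ × ℝ => p.1 + δ := measurable_fst.add measurable_const
    exact (hg.comp_measurable a1).enorm.mul
      (((hu.comp_measurable a2).sub (hu.comp_measurable a1)).enorm.add
      ((hu.comp_measurable measurable_fst).sub (hu.comp_measurable a1)).enorm)

end Increment

theorem intervalIntegral_congr_of_ae_Ioo {X : Type*} [NormedAddCommGroup X] [NormedSpace ℝ X]
    {T s t : ℝ} {a b : ℝ → X} (hab : a =ᵐ[volume.restrict (Ioo 0 T)] b) (hs : s ∈ Icc 0 T)
    (ht : t ∈ Icc 0 T) : ∫ r in s..t, a r = ∫ r in s..t, b r := by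
  refine intervalIntegral.integral_congr_ae_restrict ?_
  rw [Measure.restrict_congr_set Ioo_ae_eq_Icc] at hab
  exact ae_restrict_of_ae_restrict_of_subset
    (uIoc_subset_uIcc.trans (uIcc_subset_Icc hs ht)) hab

theorem exists_stronglyMeasurable_extension {X : Type*} [NormedAddCommGroup X] {T : ℝ}
    {u : ℝ → X} (hu : MemLp u 2 (volume.restrict (Ioo 0 T))) :
    ∃ u' : ℝ → X, u =ᵐ[volume.restrict (Ioo 0 T)] u' ∧ StronglyMeasurable u' ∧
      MemLp u' 2 volume :=
  ⟨(Ioo 0 T).indicator (hu.1.mk u),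
    hu.1.ae_eq_mk.trans (indicator_ae_eq_restrict measurableSet_Ioo).symm,
    hu.1.stronglyMeasurable_mk.indicator measurableSet_Ioo,
    (memLp_indicator_iff_restrict measurableSet_Ioo).2 (hu.ae_eq hu.1.ae_eq_mk)⟩

section Increment

variable {E F : Type*} [NormedAddCommGroup E] [NormedSpace ℝ E] [NormedAddCommGroup F]
  [InnerProductSpace ℝ F]

/-- With `t = s + δ`, the integrand of the left side is `g r` applied to `(u t - u r) + (u s - u
r)`; the substitution `r = s + σ` gives the right side. -/
theorem enorm_increment_sub_le {T : ℝ} {u : ℝ → E} {g : ℝ → StrongDual ℝ E}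
    (hg : IntegrableOn g (Ioo 0 T)) (hk : IntegrableOn (fun t => g t (u t)) (Ioo 0 T)) {s δ : ℝ}
    (hδ : 0 ≤ δ) (hs : s ∈ Icc 0 T) (ht : s + δ ∈ Icc 0 T) :
    ‖(∫ r in s..s + δ, g r) (u (s + δ) + u s) - 2 * ∫ r in s..s + δ, g r (u r)‖ₑ ≤
      ∫⁻ σ in Ioc 0 δ, ‖g (s + σ)‖ₑ * (‖u (s + δ) - u (s + σ)‖ₑ + ‖u s - u (s + σ)‖ₑ) := by
  have hst : s ≤ s + δ := by linarith
  have hI := intervalIntegrable_of_integrableOn_Ioo hg hs ht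
  have hkI := intervalIntegrable_of_integrableOn_Ioo hk hs ht
  have hgv : IntervalIntegrable (fun r => g r (u (s + δ) + u s)) volume s (s + δ) :=
    ⟨(ContinuousLinearMap.apply ℝ ℝ (u (s + δ) + u s)).integrable_comp hI.1,
      (ContinuousLinearMap.apply ℝ ℝ (u (s + δ) + u s)).integrable_comp hI.2⟩
  rw [ContinuousLinearMap.intervalIntegral_apply hI, ← intervalIntegral.integral_const_mul,
    ← intervalIntegral.integral_sub hgv (hkI.const_mul 2),
    intervalIntegral.integral_of_le hst]
  refine (enorm_integral_le_lintegral_enorm _).trans ?_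
  have e : Ioc 0 δ = (fun σ => s + σ) ⁻¹' Ioc s (s + δ) := by
    ext σ
    simp
  rw [e, (measurePreserving_add_left volume s).setLIntegral_comp_preimage_emb
    (measurableEmbedding_addLeft s)
    (fun r => ‖g r‖ₑ * (‖u (s + δ) - u r‖ₑ + ‖u s - u r‖ₑ))]
  refine lintegral_mono fun r => ?_
  have : g r (u (s + δ) + u s) - 2 * g r (u r) = g r ((u (s + δ) - u r) + (u s - u r)) := by
    simp only [map_add, map_sub]
    ring
  rw [this]
  refine ((g r).le_opENorm _).trans ?_
  gcongr
  exact enorm_add_le _ _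

/-- The function `z = y - 2 ∫ ⟨g, u⟩` has increments over time `δ` bounded by the two preceding
estimates. Their mean is at most `2δ ‖g‖` times the `L²` modulus of continuity of `u`, hence `o(δ)`,
so the weak derivative of `z` is zero. -/
theorem ae_eq_const_add_of_increment {T : ℝ} (hT : 0 < T) {u : ℝ → E} {g : ℝ → StrongDual ℝ E}
    (hum : StronglyMeasurable u) (hgm : StronglyMeasurable g) (hu : MemLp u 2 volume)
    (hg : MemLp g 2 volume) {y : ℝ → ℝ} (hy : IntegrableOn y (Ioo 0 T)) {S : Set ℝ}
    (hSae : ∀ᵐ t ∂volume.restrict (Ioo 0 T), t ∈ S)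
    (h : ∀ s ∈ S, ∀ t ∈ S, y t - y s = (∫ r in s..t, g r) (u t + u s)) :
    ∃ c, ∀ᵐ t ∂volume.restrict (Ioo 0 T), y t - 2 * ∫ r in (0 : ℝ)..t, g r (u r) = c := by
  have hk : IntegrableOn (fun t => g t (u t)) (Ioo 0 T) := (integrable_apply hg hu).integrableOn
  have hgI : IntegrableOn g (Ioo 0 T) := (hg.restrict (Ioo 0 T)).integrable (by simp)
  have hz : IntegrableOn (fun t => y t - 2 * ∫ r in (0 : ℝ)..t, g r (u r)) (Ioo 0 T) :=
    hy.sub ((integrableOn_primitive hT hk).const_mul 2)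
  refine ae_eq_const_of_integral_deriv_mul_eq_zero hT hz fun ψ p1 p2 p3 => ?_
  -- Extension by zero lets `z` be translated on the whole line; the jumps at `0` and `T` stay away
  -- from the support of `ψ`.
  set z : ℝ → ℝ := (Ioo 0 T).indicator (fun t => y t - 2 * ∫ r in (0 : ℝ)..t, g r (u r)) with hzdef
  have e : ∫ t in Ioo 0 T, deriv ψ t * (y t - 2 * ∫ r in (0 : ℝ)..t, g r (u r)) =
      ∫ t, deriv ψ t * z t := by
    rw [← integral_indicator measurableSet_Ioo]
    congr 1
    ext t
    rw [hzdef, indicator_mul_right]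
  rw [e]
  refine integral_deriv_mul_eq_zero_of_isLittleO (hz.integrable_indicator measurableSet_Ioo)
    p1 p2 fun ε hε => ?_
  obtain ⟨M, hM⟩ := p1.continuous.bounded_above_of_compact_support p2
  have hM0 : 0 ≤ M := (norm_nonneg _).trans (hM 0)
  set G := (eLpNorm g 2 volume).toReal with hG
  have hGG : eLpNorm g 2 volume = ENNReal.ofReal G := (ENNReal.ofReal_toReal hg.2.ne).symm
  -- This makes the final bound `M * (δ * (G * (2 * η)))` at most `ε * δ`; the added ones allow `M =
  -- 0` or `G = 0`.
  set η := ε / (2 * (M + 1) * (G + 1)) with hη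
  have hG0 : 0 ≤ G := ENNReal.toReal_nonneg
  have hηpos : 0 < η := by positivity
  have hηle : M * (G * (2 * η)) ≤ ε := by
    rw [hη]
    have : M * (G * (2 * (ε / (2 * (M + 1) * (G + 1))))) = ε * ((M / (M + 1)) * (G / (G + 1))) := by
      field_simp
    rw [this]
    have h1 : M / (M + 1) ≤ 1 := (div_le_one (by positivity)).2 (by linarith)
    have h2 : G / (G + 1) ≤ 1 := (div_le_one (by positivity)).2 (by linarith)
    have h3 : (M / (M + 1)) * (G / (G + 1)) ≤ 1 := mul_le_one₀ h1 (by positivity) h2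
    nlinarith
  have htr := (tendsto_eLpNorm_translate_sub hu).eventually_le_const
    (ENNReal.ofReal_pos.2 hηpos)
  obtain ⟨δ₀, hδ₀, hball⟩ := Metric.eventually_nhds_iff.1 htr
  -- The gap `T - b` bounds the shifts `δ` for which `r + δ` remains in `(0, T)` when `r` is in the
  -- support of `ψ`.
  obtain ⟨b, hbT, hb⟩ : ∃ b < T, ∀ r ∈ tsupport ψ, r ≤ b := by
    rcases (tsupport ψ).eq_empty_or_nonempty with he | hne
    · exact ⟨0, hT, by simp [he]⟩
    · obtain ⟨b, hb⟩ := p2.isCompact.exists_isGreatest hne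
      exact ⟨b, (p3 hb.1).2, fun r hr => hb.2 hr⟩
  have hSr : ∀ᵐ r : ℝ, r ∈ Ioo 0 T → r ∈ S := (ae_restrict_iff' measurableSet_Ioo).1 hSae
  filter_upwards [Ioo_mem_nhdsGT hδ₀, Ioo_mem_nhdsGT (sub_pos.2 hbT)] with δ hδ1 hδ2
  have hSr' : ∀ᵐ r : ℝ, r + δ ∈ Ioo 0 T → r + δ ∈ S :=
    (measurePreserving_add_right volume δ).quasiMeasurePreserving.ae hSr
  have hest : ‖∫ r, ψ r * (z (r + δ) - z r)‖ₑ ≤ ENNReal.ofReal (ε * δ) := by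
    calc ‖∫ r, ψ r * (z (r + δ) - z r)‖ₑ ≤ ∫⁻ r, ‖ψ r * (z (r + δ) - z r)‖ₑ :=
          enorm_integral_le_lintegral_enorm _
      _ ≤ ∫⁻ r, ENNReal.ofReal M * ∫⁻ σ in Ioc 0 δ, ‖g (r + σ)‖ₑ *
            (‖u (r + δ) - u (r + σ)‖ₑ + ‖u r - u (r + σ)‖ₑ) := by
          refine lintegral_mono_ae ?_
          filter_upwards [hSr, hSr'] with r h1 h2
          by_cases hr : r ∈ tsupport ψ
          · have i1 := p3 hr
            have i2 : r + δ ∈ Ioo 0 T :=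
              ⟨by linarith [i1.1, hδ1.1], by linarith [hb r hr, hδ2.2]⟩
            rw [enorm_mul]
            refine mul_le_mul' ?_ ?_
            · rw [← ofReal_norm]
              exact ENNReal.ofReal_le_ofReal (hM r)
            · refine le_trans (le_of_eq ?_) (enorm_increment_sub_le hgI hk hδ1.1.le
                (Ioo_subset_Icc_self i1) (Ioo_subset_Icc_self i2))
              have hJ := fun a ha b hb => intervalIntegrable_of_integrableOn_Ioo (s := a) (t := b)
                hk ha hb
              have h0 : (0 : ℝ) ∈ Icc 0 T := left_mem_Icc.2 hT.le
              rw [hzdef, indicator_of_mem i1, indicator_of_mem i2, ← h _ (h1 i1) _ (h2 i2),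
                ← intervalIntegral.integral_interval_sub_left
                  (hJ _ h0 _ (Ioo_subset_Icc_self i2)) (hJ _ h0 _ (Ioo_subset_Icc_self i1))]
              congr 1
              ring
          · simp [image_eq_zero_of_notMem_tsupport hr]
      _ ≤ ENNReal.ofReal M * (ENNReal.ofReal δ * (eLpNorm g 2 volume * (2 * ENNReal.ofReal η))) := by
          rw [lintegral_const_mul' _ _ ENNReal.ofReal_ne_top]
          gcongr
          refine lintegral_increment_le hum hgm fun σ hσ => hball ?_
          rw [Real.dist_eq, sub_zero, abs_of_nonneg hσ.1]
          exact hσ.2.trans_lt hδ1.2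
      _ = ENNReal.ofReal (M * (δ * (G * (2 * η)))) := by
          rw [hGG, ENNReal.ofReal_mul hM0, ENNReal.ofReal_mul hδ1.1.le, ENNReal.ofReal_mul hG0,
            ENNReal.ofReal_mul zero_le_two, ENNReal.ofReal_ofNat]
      _ ≤ _ := ENNReal.ofReal_le_ofReal (by
        have := hδ1.1
        nlinarith)
  rw [← ofReal_norm, ENNReal.ofReal_le_ofReal_iff (mul_pos hε hδ1.1).le] at hest
  exact hest

/-- The energy identity of Lions: if `u ∈ L²(0, T; E)` has a weak time derivative
`g ∈ L²(0, T; E')`, then `‖u(t)‖² - 2 ∫₀ᵗ ⟨g, u⟩` is constant. -/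
theorem ae_norm_sq_sub_integral_eq_const [SecondCountableTopology E] {T : ℝ} (hT : 0 < T)
    (j : E →L[ℝ] F) {u : ℝ → E} {g : ℝ → StrongDual ℝ E}
    (hu : MemLp u 2 (volume.restrict (Ioo 0 T))) (hg : MemLp g 2 (volume.restrict (Ioo 0 T)))
    (hw : ∀ ψ : ℝ → ℝ, ContDiff ℝ ∞ ψ → HasCompactSupport ψ → tsupport ψ ⊆ Ioo 0 T → ∀ v : E,
      ∫ t in Ioo 0 T, deriv ψ t * inner ℝ (j (u t)) (j v) = -∫ t in Ioo 0 T, ψ t * g t v) :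
    ∃ c, ∀ᵐ t ∂volume.restrict (Ioo 0 T),
      ‖j (u t)‖ ^ 2 - 2 * ∫ r in (0 : ℝ)..t, g r (u r) = c := by
  obtain ⟨S, hS, hSae, hSinc⟩ := ae_inner_sub_eq_integral hT j (hu.integrable (by simp))
    (hg.integrable (by simp)) hw
  -- Strongly measurable representatives on all of `ℝ` provide the joint measurability in `(r, σ)`
  -- for Tonelli and make translation meaningful.
  obtain ⟨u', hu', hum, hu2⟩ := exists_stronglyMeasurable_extension hu
  obtain ⟨g', hg', hgm, hg2⟩ := exists_stronglyMeasurable_extension hg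
  have hinc : ∀ s ∈ S ∩ {t | u t = u' t}, ∀ t ∈ S ∩ {t | u t = u' t},
      ‖j (u t)‖ ^ 2 - ‖j (u s)‖ ^ 2 = (∫ r in s..t, g' r) (u' t + u' s) := by
    rintro s ⟨hs1, hs2⟩ t ⟨ht1, ht2⟩
    rw [← intervalIntegral_congr_of_ae_Ioo hg' (Ioo_subset_Icc_self (hS hs1))
      (Ioo_subset_Icc_self (hS ht1)),
      ← hs2, ← ht2, ← hSinc s hs1 t ht1, map_add, inner_sub_left, inner_add_right, inner_add_right,
      real_inner_self_eq_norm_sq, real_inner_self_eq_norm_sq, real_inner_comm (j (u s)) (j (u t))]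
    ring
  obtain ⟨c, hc⟩ := ae_eq_const_add_of_increment hT hum hgm hu2 hg2
    ((j.comp_memLp' hu).integrable_norm_pow (p := 2) (by simp)) (hSae.and hu') hinc
  refine ⟨c, ?_⟩
  filter_upwards [hc, ae_restrict_mem measurableSet_Ioo] with t h1 h2
  rw [← h1, intervalIntegral_congr_of_ae_Ioo (b := fun r => g' r (u' r)) ?_
    (left_mem_Icc.2 hT.le) (Ioo_subset_Icc_self h2)]
  · rfl
  · filter_upwards [hu', hg'] with r h3 h4
    rw [h3, h4]

end Increment

/-! ### Grönwall's inequality and vanishing primitives -/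

/-- Grönwall's inequality with an integrable coefficient. -/
theorem primitive_nonpos_of_le_mul {T : ℝ} (hT : 0 < T) {a k : ℝ → ℝ}
    (ha : IntegrableOn a (Ioo 0 T)) (ha0 : ∀ t, 0 ≤ a t) (hk : IntegrableOn k (Ioo 0 T))
    (h : ∀ᵐ t ∂volume.restrict (Ioo 0 T), k t ≤ a t * ∫ s in (0 : ℝ)..t, k s) :
    ∀ t ∈ Icc 0 T, ∫ s in (0 : ℝ)..t, k s ≤ 0 := by
  have h0 : (0 : ℝ) ∈ Icc 0 T := left_mem_Icc.2 hT.le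
  have cont : ∀ {f : ℝ → ℝ}, IntegrableOn f (Ioo 0 T) →
      ContinuousOn (fun t => ∫ s in (0 : ℝ)..t, f s) (Icc 0 T) := by
    intro f hf
    have := intervalIntegral.continuousOn_primitive_interval' (intervalIntegrable_of_integrableOn_Ioo
      hf h0 (right_mem_Icc.2 hT.le)) left_mem_uIcc
    rwa [uIcc_of_le hT.le] at this
  set Y : ℝ → ℝ := fun t => ∫ s in (0 : ℝ)..t, k s with hY
  have hcl : IsClosed ({t | Y t ≤ 0} ∩ Icc 0 T) := by
    rw [inter_comm]
    exact (cont hk).preimage_isClosed_of_isClosed isClosed_Icc isClosed_Iic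
  -- Continuous induction: from a point `x` with `Y x ≤ 0` one advances to some `t > x` so close
  -- that `∫ₓᵗ a < 1 / 2`.
  refine hcl.Icc_subset_of_forall_exists_gt (by simp [hY]) ?_
  rintro x ⟨hx0, hx⟩ y hy
  have hxI : x ∈ Icc 0 T := Ico_subset_Icc_self hx
  have hA := (cont ha) x hxI
  have hev : ∀ᶠ t in 𝓝[Icc 0 T] x, ∫ s in (0 : ℝ)..t, a s < (∫ s in (0 : ℝ)..x, a s) + 1 / 2 :=
    hA.eventually_lt_const (by linarith)
  have hle : 𝓝[>] x ≤ 𝓝[Icc 0 T] x := by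
    rw [← nhdsWithin_Ioo_eq_nhdsGT hx.2]
    exact nhdsWithin_mono _ (Ioo_subset_Icc_self.trans (Icc_subset_Icc_left hx.1))
  obtain ⟨t, ht1, ht2⟩ := ((hev.filter_mono hle).and (Ioo_mem_nhdsGT (lt_min hx.2 hy))).exists
  have htT : t ∈ Icc 0 T := ⟨hx.1.trans ht2.1.le, (ht2.2.trans_le (min_le_left _ _)).le⟩
  refine ⟨t, ?_, ht2.1, (ht2.2.trans_le (min_le_right _ _)).le⟩
  have hsub : Icc x t ⊆ Icc 0 T := Icc_subset_Icc hx.1 htT.2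
  -- A positive maximum would satisfy `Y m ≤ Y x + Y m * ∫ₓᵐ a ≤ Y m / 2`, which is absurd.
  obtain ⟨m, hm1, hm2⟩ := isCompact_Icc.exists_isMaxOn (nonempty_Icc.2 ht2.1.le) ((cont hk).mono hsub)
  have hYm : Y m ≤ 0 := by
    by_contra! hpos
    have ik := intervalIntegrable_of_integrableOn_Ioo hk hxI (hsub hm1)
    have ia := intervalIntegrable_of_integrableOn_Ioo ha hxI (hsub hm1)
    have ia' := intervalIntegrable_of_integrableOn_Ioo ha (hsub hm1) htT
    have e1 : Y m - Y x = ∫ s in x..m, k s :=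
      intervalIntegral.integral_interval_sub_left
        (intervalIntegrable_of_integrableOn_Ioo hk h0 (hsub hm1))
        (intervalIntegrable_of_integrableOn_Ioo hk h0 hxI)
    have e2 : ∫ s in x..m, k s ≤ ∫ s in x..m, a s * Y m := by
      refine intervalIntegral.integral_mono_ae_restrict hm1.1 ik (ia.mul_const _) ?_
      have h' := h
      rw [Measure.restrict_congr_set Ioo_ae_eq_Icc] at h'
      have hsub' : Icc x m ⊆ Icc x t := Icc_subset_Icc_right hm1.2
      filter_upwards [ae_restrict_of_ae_restrict_of_subset (hsub'.trans hsub) h',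
        ae_restrict_mem measurableSet_Icc] with s hs1 hs2
      exact hs1.trans (mul_le_mul_of_nonneg_left (hm2 (hsub' hs2)) (ha0 s))
    have e3 : ∫ s in x..m, a s ≤ ∫ s in x..t, a s := by
      rw [← intervalIntegral.integral_add_adjacent_intervals ia ia']
      linarith [intervalIntegral.integral_nonneg (μ := volume) hm1.2 fun s _ => ha0 s]
    have e4 : (∫ s in (0 : ℝ)..t, a s) - ∫ s in (0 : ℝ)..x, a s = ∫ s in x..t, a s :=
      intervalIntegral.integral_interval_sub_left
        (intervalIntegrable_of_integrableOn_Ioo ha h0 htT)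
        (intervalIntegrable_of_integrableOn_Ioo ha h0 hxI)
    rw [intervalIntegral.integral_mul_const] at e2
    have hx0' : Y x ≤ 0 := hx0
    nlinarith
  exact (hm2 (right_mem_Icc.2 ht2.1.le)).trans hYm

/-- An integrable function with vanishing primitive vanishes. -/
theorem ae_eq_zero_of_primitive_ae_eq_zero {T : ℝ} (hT : 0 < T) {k : ℝ → ℝ}
    (hk : IntegrableOn k (Ioo 0 T))
    (h : ∀ᵐ t ∂volume.restrict (Ioo 0 T), ∫ s in (0 : ℝ)..t, k s = 0) :
    ∀ᵐ t ∂volume.restrict (Ioo 0 T), k t = 0 := by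
  rw [ae_restrict_iff' measurableSet_Ioo]
  refine isOpen_Ioo.ae_eq_zero_of_integral_contDiff_smul_eq_zero hk.locallyIntegrableOn ?_
  intro ψ p1 p2 p3
  have e := integral_deriv_mul_primitive hT hk p1 p3
  rw [integral_eq_zero_of_ae (by filter_upwards [h] with t ht; simp [ht])] at e
  rw [← setIntegral_eq_integral_of_forall_compl_eq_zero (s := Ioo 0 T)]
  · simpa using e.symm
  · intro x hx
    simp [image_eq_zero_of_notMem_tsupport fun h' => hx (p3 h')]

/-! ### Ladyzhenskaya's inequality -/

theorem mem_H10_of_forall_testGraph {Ω : Set Plane} {p : Graph Ω → Prop}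
    (hp : IsClosed {w | p w}) (h : ∀ w ∈ testGraph Ω, p w) {w : Graph Ω} (hw : w ∈ H10 Ω) : p w :=
  closure_minimal (s := (testGraph Ω : Set (Graph Ω))) (t := {w | p w}) h hp hw

theorem norm_fderiv_le_norm_grad (v : Plane → Plane) (x : Plane) :
    ‖fderiv ℝ v x‖ ≤ ‖grad v x‖ := by
  refine ContinuousLinearMap.opNorm_le_bound _ (norm_nonneg _) fun e => ?_
  have he : e = e 0 • EuclideanSpace.single 0 1 + e 1 • EuclideanSpace.single 1 1 := by
    ext i
    fin_cases i <;> simp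
  have hc : ∀ i, fderiv ℝ v x e i = e 0 * grad v x (i, 0) + e 1 * grad v x (i, 1) := by
    intro i
    conv_lhs => rw [he]
    simp [grad]
  rw [← abs_of_nonneg (norm_nonneg (fderiv ℝ v x e)),
    ← abs_of_nonneg (mul_nonneg (norm_nonneg (grad v x)) (norm_nonneg e)), ← sq_le_sq, mul_pow,
    EuclideanSpace.norm_sq_eq, EuclideanSpace.norm_sq_eq, EuclideanSpace.norm_sq_eq,
    Fintype.sum_prod_type]
  simp only [Fin.sum_univ_two, hc, Real.norm_eq_abs, sq_abs]
  nlinarith [sq_nonneg (e 0 * grad v x (0, 1) - e 1 * grad v x (0, 0)),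
    sq_nonneg (e 0 * grad v x (1, 1) - e 1 * grad v x (1, 0))]

theorem continuous_grad {v : Plane → Plane} (hv : ContDiff ℝ ∞ v) : Continuous (grad v) := by
  have h := hv.continuous_fderiv (by simp)
  refine (PiLp.continuous_toLp 2 _).comp (continuous_pi fun p => ?_)
  fun_prop

/-- The constant in Ladyzhenskaya's inequality. -/
def ladyzhenskayaConst : NNReal :=
  4 * lintegralPowLePowLIntegralFDerivConst (volume : Measure Plane) 2

/-- The Gagliardo–Nirenberg–Sobolev inequality for `W^{1,1}` in dimension two is applied to `|v|²`,
whose gradient is at most `2 |v| |∇v|`; Cauchy–Schwarz splits the product. The factor `4` in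
`ladyzhenskayaConst` is the square of that `2`. -/
theorem lintegral_pow_four_le_of_isTestField {Ω : Set Plane} {v : Plane → Plane}
    (hv : IsTestField Ω v) :
    ∫⁻ x in Ω, ‖v x‖ₑ ^ 4 ≤ ladyzhenskayaConst *
      (eLpNorm v 2 (volume.restrict Ω) * eLpNorm (grad v) 2 (volume.restrict Ω)) ^ 2 := by
  obtain ⟨h1, h2, h3⟩ := hv
  have hq : ContDiff ℝ 1 (fun x => ‖v x‖ ^ 2) := (h1.norm_sq ℝ).of_le (by simp)
  have hqc : HasCompactSupport (fun x => ‖v x‖ ^ 2) :=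
    h2.comp_left (g := fun y : Plane => ‖y‖ ^ 2) (by simp)
  have hfin : Module.finrank ℝ Plane = 2 := by simp
  have hp : Real.HolderConjugate (Module.finrank ℝ Plane : ℝ) 2 := by
    rw [hfin]
    exact_mod_cast Real.HolderConjugate.two_two
  have hd : ∀ x, ‖fderiv ℝ (fun x => ‖v x‖ ^ 2) x‖ₑ ≤ 2 * (‖v x‖ₑ * ‖grad v x‖ₑ) := by
    intro x
    have hvx := (h1.differentiable (by simp) x).hasFDerivAt
    rw [hvx.norm_sq.fderiv]
    have : ‖2 • (innerSL ℝ (v x)).comp (fderiv ℝ v x)‖ ≤ 2 * (‖v x‖ * ‖grad v x‖) := by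
      refine (norm_nsmul_le).trans ?_
      simp only [Nat.cast_ofNat]
      gcongr
      refine (ContinuousLinearMap.opNorm_comp_le _ _).trans ?_
      rw [innerSL_apply_norm]
      gcongr
      exact norm_fderiv_le_norm_grad v x
    rw [← ofReal_norm, ← ofReal_norm, ← ofReal_norm, ← ENNReal.ofReal_mul (norm_nonneg _)]
    refine (ENNReal.ofReal_le_ofReal this).trans_eq ?_
    rw [ENNReal.ofReal_mul zero_le_two, ENNReal.ofReal_ofNat]
  have hdz : ∀ x ∉ Ω, ‖fderiv ℝ (fun x => ‖v x‖ ^ 2) x‖ₑ = 0 := by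
    intro x hx
    have := hd x
    rw [image_eq_zero_of_notMem_tsupport fun h => hx (h3 h)] at this
    simpa using this
  have key := lintegral_pow_le_pow_lintegral_fderiv (μ := (volume : Measure Plane)) hq hqc hp
  have hle : ∫⁻ x, ‖fderiv ℝ (fun x => ‖v x‖ ^ 2) x‖ₑ ≤
      2 * (eLpNorm v 2 (volume.restrict Ω) * eLpNorm (grad v) 2 (volume.restrict Ω)) := by
    rw [← setLIntegral_eq_of_support_subset (s := Ω) ?_]
    · refine (lintegral_mono hd).trans ?_
      rw [lintegral_const_mul' _ _ (by simp)]
      gcongr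
      exact lintegral_enorm_mul_le h1.continuous.aestronglyMeasurable
        (continuous_grad h1).aestronglyMeasurable
    · intro x hx
      by_contra hx'
      exact hx (hdz x hx')
  calc ∫⁻ x in Ω, ‖v x‖ₑ ^ 4 ≤ ∫⁻ x, ‖v x‖ₑ ^ 4 := setLIntegral_le_lintegral _ _
    _ = ∫⁻ x, ‖‖v x‖ ^ 2‖ₑ ^ (2 : ℝ) := by
      congr 1
      ext x
      rw [enorm_pow, enorm_norm]
      norm_cast
      rw [← pow_mul]
    _ ≤ _ := key
    _ ≤ lintegralPowLePowLIntegralFDerivConst (volume : Measure Plane) 2 *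
        (2 * (eLpNorm v 2 (volume.restrict Ω) * eLpNorm (grad v) 2 (volume.restrict Ω))) ^ (2 : ℝ) := by
      gcongr
    _ = _ := by
      rw [ladyzhenskayaConst]
      norm_cast
      rw [mul_pow]
      push_cast
      ring

theorem lintegral_pow_four_le_of_mem_testGraph {Ω : Set Plane} {w : Graph Ω}
    (hw : w ∈ testGraph Ω) :
    ∫⁻ x in Ω, ‖w.fst x‖ₑ ^ 4 ≤ ladyzhenskayaConst * (‖w.fst‖ₑ * ‖w.snd‖ₑ) ^ 2 := by
  obtain ⟨v, hv, h1, h2⟩ := hw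
  rw [Lp.enorm_def, Lp.enorm_def, eLpNorm_congr_ae h1, eLpNorm_congr_ae h2]
  refine le_trans (le_of_eq (lintegral_congr_ae ?_)) (lintegral_pow_four_le_of_isTestField hv)
  filter_upwards [h1] with x hx
  rw [hx]

/-- Ladyzhenskaya's inequality in the plane. -/
theorem lintegral_pow_four_le {Ω : Set Plane} {w : Graph Ω} (hw : w ∈ H10 Ω) :
    ∫⁻ x in Ω, ‖w.fst x‖ₑ ^ 4 ≤ ladyzhenskayaConst * (‖w.fst‖ₑ * ‖w.snd‖ₑ) ^ 2 := by
  obtain ⟨a, ha, hlim⟩ := mem_closure_iff_seq_limit.1 (show w ∈ closure (testGraph Ω : Set _) from hw)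
  have hf : Tendsto (fun n => (a n).fst) atTop (𝓝 w.fst) :=
    ((WithLp.prod_continuous_ofLp 2 _ _).fst.tendsto w).comp hlim
  have hs : Tendsto (fun n => (a n).snd) atTop (𝓝 w.snd) :=
    ((WithLp.prod_continuous_ofLp 2 _ _).snd.tendsto w).comp hlim
  -- Finiteness of the `L⁴` norm of the limit is not yet known, so the bound passes to it by Fatou
  -- along an almost everywhere convergent subsequence.
  obtain ⟨ns, hns, hae⟩ := (tendstoInMeasure_of_tendsto_Lp hf).exists_seq_tendsto_ae
  have hlim2 : Tendsto (fun n => (ladyzhenskayaConst : ENNReal) *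
      (‖(a (ns n)).fst‖ₑ * ‖(a (ns n)).snd‖ₑ) ^ 2) atTop
      (𝓝 (ladyzhenskayaConst * (‖w.fst‖ₑ * ‖w.snd‖ₑ) ^ 2)) := by
    have t1 := (hf.comp hns.tendsto_atTop).enorm
    have t2 := (hs.comp hns.tendsto_atTop).enorm
    refine ENNReal.Tendsto.const_mul (((ENNReal.continuous_pow 2).tendsto _).comp
      (ENNReal.Tendsto.mul t1 (Or.inr enorm_ne_top) t2 (Or.inr enorm_ne_top))) (Or.inr (by simp))
  calc ∫⁻ x in Ω, ‖w.fst x‖ₑ ^ 4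
      = ∫⁻ x in Ω, liminf (fun n => ‖(a (ns n)).fst x‖ₑ ^ 4) atTop := by
        refine lintegral_congr_ae ?_
        filter_upwards [hae] with x hx
        exact (((ENNReal.continuous_pow 4).tendsto _).comp hx.enorm).liminf_eq.symm
    _ ≤ liminf (fun n => ∫⁻ x in Ω, ‖(a (ns n)).fst x‖ₑ ^ 4) atTop :=
        lintegral_liminf_le' fun n => (Lp.aestronglyMeasurable _).enorm.pow_const 4
    _ ≤ liminf (fun n => (ladyzhenskayaConst : ENNReal) *
          (‖(a (ns n)).fst‖ₑ * ‖(a (ns n)).snd‖ₑ) ^ 2) atTop :=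
        liminf_le_liminf (Eventually.of_forall fun n =>
          lintegral_pow_four_le_of_mem_testGraph (ha (ns n)))
    _ = _ := hlim2.liminf_eq

/-- The constant in the `L⁴` form of Ladyzhenskaya's inequality. -/
def ladyzhenskayaConstFour : NNReal := NNReal.sqrt ladyzhenskayaConst

theorem eLpNorm_four_sq_le {Ω : Set Plane} {w : Graph Ω} (hw : w ∈ H10 Ω) :
    eLpNorm w.fst 4 (volume.restrict Ω) ^ 2 ≤
      ladyzhenskayaConstFour * (‖w.fst‖ₑ * ‖w.snd‖ₑ) := by
  have h := lintegral_pow_four_le hw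
  have e : ∫⁻ x in Ω, ‖w.fst x‖ₑ ^ 4 = (eLpNorm w.fst 4 (volume.restrict Ω) ^ 2) ^ 2 := by
    rw [← pow_mul]
    have := eLpNorm_nnreal_pow_eq_lintegral (f := w.fst) (μ := volume.restrict Ω) (p := 4) (by simp)
    simp only [NNReal.coe_ofNat, ENNReal.coe_ofNat, ENNReal.rpow_ofNat] at this
    exact this.symm
  have e2 : (ladyzhenskayaConst : ENNReal) = (ladyzhenskayaConstFour : ENNReal) ^ 2 := by
    rw [ladyzhenskayaConstFour]
    norm_cast
    simp
  rw [e, e2, ← mul_pow] at h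
  exact (ENNReal.pow_le_pow_left_iff two_ne_zero).1 h

/-! ### Korn's inequality -/

/-- `symPart` as a continuous linear map. -/
def symPartL : Mat2 →L[ℝ] Mat2 := LinearMap.toContinuousLinearMap
  { toFun := symPart
    map_add' := fun A B => by
      ext p
      simp [symPart]
      ring
    map_smul' := fun c A => by
      ext p
      simp [symPart]
      ring }

/-- The symmetric part of a square-integrable matrix field. -/
def symPartLp (Ω : Set Plane) : L2Mat Ω →L[ℝ] L2Mat Ω :=
  symPartL.compLpL 2 (volume.restrict Ω)

theorem coeFn_symPartLp {Ω : Set Plane} (A : L2Mat Ω) :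
    symPartLp Ω A =ᵐ[volume.restrict Ω] fun x => symPart (A x) :=
  symPartL.coeFn_compLpL A

/-- The difference of the two sides is exactly `(tr A)²`. For a gradient of a test field the
determinant integrates to zero, which leaves Korn's inequality with constant `2`. -/
theorem norm_sq_le_symPart_add_det (A : Mat2) :
    ‖A‖ ^ 2 ≤ 2 * ‖symPart A‖ ^ 2 + 2 * (A (0, 0) * A (1, 1) - A (0, 1) * A (1, 0)) := by
  rw [EuclideanSpace.norm_sq_eq, EuclideanSpace.norm_sq_eq, Fintype.sum_prod_type,
    Fintype.sum_prod_type]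
  simp only [Fin.sum_univ_two, symPart, Real.norm_eq_abs, sq_abs]
  nlinarith [sq_nonneg (A (0, 0) + A (1, 1))]

theorem grad_apply {v : Plane → Plane} (hv : ContDiff ℝ ∞ v) (x : Plane) (i j : Fin 2) :
    grad v x (i, j) = fderiv ℝ (fun y => v y i) x (EuclideanSpace.single j 1) := by
  have h := ((EuclideanSpace.proj (𝕜 := ℝ) i).hasFDerivAt.comp x
    (hv.differentiable (by simp) x).hasFDerivAt).fderiv
  have e : (fun y => v y i) = (EuclideanSpace.proj (𝕜 := ℝ) i) ∘ v := rfl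
  rw [e, h]
  simp [grad]

theorem contDiff_apply_of_isTestField {Ω : Set Plane} {v : Plane → Plane} (hv : IsTestField Ω v)
    (i : Fin 2) : ContDiff ℝ ∞ (fun y => v y i) :=
  (EuclideanSpace.proj (𝕜 := ℝ) i).contDiff.comp hv.1

theorem hasCompactSupport_apply_of_isTestField {Ω : Set Plane} {v : Plane → Plane}
    (hv : IsTestField Ω v) (i : Fin 2) : HasCompactSupport (fun y => v y i) :=
  hv.2.1.comp_left (g := fun y : Plane => y i) (by simp)

theorem integral_mul_fderiv_eq_neg {f g : Plane → ℝ} (hf : ContDiff ℝ ∞ f)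
    (hg : ContDiff ℝ ∞ g) (hc : HasCompactSupport f) (e : Plane) :
    ∫ x, f x * fderiv ℝ g x e = -∫ x, fderiv ℝ f x e * g x := by
  have c1 : Continuous fun x => fderiv ℝ f x e :=
    (hf.continuous_fderiv (by simp)).clm_apply continuous_const
  have c2 : Continuous fun x => fderiv ℝ g x e :=
    (hg.continuous_fderiv (by simp)).clm_apply continuous_const
  have hc' : HasCompactSupport fun x => fderiv ℝ f x e :=
    (hc.fderiv ℝ).comp_left (g := fun L : Plane →L[ℝ] ℝ => L e) (by simp)
  refine integral_mul_fderiv_eq_neg_fderiv_mul_of_integrable ?_ ?_ ?_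
    (fun x _ => hf.differentiable (by simp) x) (fun x _ => hg.differentiable (by simp) x)
  · exact (c1.mul hg.continuous).integrable_of_hasCompactSupport hc'.mul_right
  · exact (hf.continuous.mul c2).integrable_of_hasCompactSupport hc.mul_right
  · exact (hf.continuous.mul hg.continuous).integrable_of_hasCompactSupport hc.mul_right

/-- The Jacobian is a null Lagrangian: moving the derivative off `f` on either side produces `-∫ f
∂ₐ∂_b g`, by symmetry of second derivatives. -/
theorem integral_det_fderiv_eq_zero {f g : Plane → ℝ} (hf : ContDiff ℝ ∞ f)
    (hg : ContDiff ℝ ∞ g) (hc : HasCompactSupport f) (a b : Plane) :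
    ∫ x, fderiv ℝ f x a * fderiv ℝ g x b = ∫ x, fderiv ℝ f x b * fderiv ℝ g x a := by
  have hd : ∀ e, ContDiff ℝ ∞ fun x => fderiv ℝ g x e := fun e =>
    (hg.fderiv_right (m := ∞) (by simp)).clm_apply contDiff_const
  have h1 := integral_mul_fderiv_eq_neg hf (hd b) hc a
  have h2 := integral_mul_fderiv_eq_neg hf (hd a) hc b
  have hsymm : ∀ x, fderiv ℝ (fun x => fderiv ℝ g x b) x a =
      fderiv ℝ (fun x => fderiv ℝ g x a) x b := by
    intro x
    have hg' : DifferentiableAt ℝ (fderiv ℝ g) x :=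
      (hg.fderiv_right (m := ∞) (by simp)).differentiable (by simp) x
    rw [fderiv_clm_apply hg' (differentiableAt_const _),
      fderiv_clm_apply hg' (differentiableAt_const _)]
    have h2 : minSmoothness ℝ 2 ≤ (∞ : WithTop ℕ∞) := by
      rw [minSmoothness_of_isRCLikeNormedField]
      exact WithTop.coe_le_coe.2 (le_top : (2 : ℕ∞) ≤ ⊤)
    have := (hg.contDiffAt (x := x)).isSymmSndFDerivAt h2
    simpa using this a b
  simp only [hsymm] at h1
  linarith

theorem norm_sq_Lp_eq_integral {Ω : Set Plane} {E : Type*} [NormedAddCommGroup E]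
    [InnerProductSpace ℝ E] (f : Lp E 2 (volume.restrict Ω)) : ‖f‖ ^ 2 = ∫ x in Ω, ‖f x‖ ^ 2 := by
  rw [← real_inner_self_eq_norm_sq, L2.inner_def]
  simp only [real_inner_self_eq_norm_sq]

theorem hasCompactSupport_grad {v : Plane → Plane} (hv : HasCompactSupport v) :
    HasCompactSupport (grad v) :=
  (hv.fderiv ℝ).comp_left (g := fun L : Plane →L[ℝ] Plane =>
    (WithLp.toLp 2 fun p => L (EuclideanSpace.single p.2 1) p.1 : Mat2)) (by ext; simp)

theorem grad_eq_zero_of_notMem {Ω : Set Plane} {v : Plane → Plane} (hv : IsTestField Ω v)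
    {x : Plane} (hx : x ∉ Ω) : grad v x = 0 := by
  have : fderiv ℝ v x = 0 := image_eq_zero_of_notMem_tsupport fun h =>
    hx (hv.2.2 (tsupport_fderiv_subset ℝ h))
  ext p
  simp [grad, this]

theorem continuous_grad_apply {v : Plane → Plane} (hv : ContDiff ℝ ∞ v) (p : Fin 2 × Fin 2) :
    Continuous fun x => grad v x p :=
  (EuclideanSpace.proj (𝕜 := ℝ) p).continuous.comp (continuous_grad hv)

theorem integrable_grad_mul_grad {Ω : Set Plane} {v : Plane → Plane} (hv : IsTestField Ω v)
    (p q : Fin 2 × Fin 2) : Integrable fun x => grad v x p * grad v x q :=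
  ((continuous_grad_apply hv.1 p).mul
    (continuous_grad_apply hv.1 q)).integrable_of_hasCompactSupport
    ((hasCompactSupport_grad hv.2.1).comp_left (g := fun A : Mat2 => A p * A q) (by simp))

theorem integral_det_grad_eq_zero {Ω : Set Plane} {v : Plane → Plane} (hv : IsTestField Ω v) :
    ∫ x in Ω, (grad v x (0, 0) * grad v x (1, 1) - grad v x (0, 1) * grad v x (1, 0)) = 0 := by
  rw [setIntegral_eq_integral_of_forall_compl_eq_zero,
    integral_sub (integrable_grad_mul_grad hv _ _) (integrable_grad_mul_grad hv _ _)]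
  · simp only [grad_apply hv.1]
    rw [integral_det_fderiv_eq_zero (contDiff_apply_of_isTestField hv 0)
      (contDiff_apply_of_isTestField hv 1) (hasCompactSupport_apply_of_isTestField hv 0), sub_self]
  · intro x hx
    simp [grad_eq_zero_of_notMem hv hx]

theorem integrable_norm_sq_of_hasCompactSupport {E : Type*} [NormedAddCommGroup E]
    {F : Plane → E} (hF : Continuous F) (hc : HasCompactSupport F) :
    Integrable fun x => ‖F x‖ ^ 2 := by
  have h1 : Continuous fun x => ‖F x‖ ^ 2 := hF.norm.pow 2
  have h2 : HasCompactSupport fun x => ‖F x‖ ^ 2 :=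
    hc.comp_left (g := fun A : E => ‖A‖ ^ 2) (by simp)
  exact h1.integrable_of_hasCompactSupport h2

theorem integral_norm_grad_sq_le {Ω : Set Plane} {v : Plane → Plane} (hv : IsTestField Ω v) :
    ∫ x in Ω, ‖grad v x‖ ^ 2 ≤ 2 * ∫ x in Ω, ‖symPart (grad v x)‖ ^ 2 := by
  have hgc := hasCompactSupport_grad hv.2.1
  have hcont := continuous_grad hv.1
  have hcs : Continuous fun x => symPart (grad v x) := symPartL.continuous.comp hcont
  have i1 := (integrable_norm_sq_of_hasCompactSupport hcont hgc).restrict (s := Ω)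
  have i2 := (integrable_norm_sq_of_hasCompactSupport hcs
    (hgc.comp_left (g := symPartL) (map_zero _))).restrict (s := Ω)
  have i3 : Integrable (fun x => grad v x (0, 0) * grad v x (1, 1) -
      grad v x (0, 1) * grad v x (1, 0)) (volume.restrict Ω) :=
    ((integrable_grad_mul_grad hv (0, 0) (1, 1)).sub
      (integrable_grad_mul_grad hv (0, 1) (1, 0))).restrict
  calc ∫ x in Ω, ‖grad v x‖ ^ 2
      ≤ ∫ x in Ω, (2 * ‖symPart (grad v x)‖ ^ 2 + 2 * (grad v x (0, 0) * grad v x (1, 1) -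
          grad v x (0, 1) * grad v x (1, 0))) :=
        integral_mono i1 ((i2.const_mul 2).add (i3.const_mul 2))
          fun x => norm_sq_le_symPart_add_det (grad v x)
    _ = 2 * ∫ x in Ω, ‖symPart (grad v x)‖ ^ 2 := by
        rw [integral_add (i2.const_mul 2) (i3.const_mul 2), integral_const_mul, integral_const_mul,
          integral_det_grad_eq_zero hv, mul_zero, add_zero]

theorem continuous_graph_fst {Ω : Set Plane} : Continuous fun w : Graph Ω => w.fst :=
  (WithLp.prod_continuous_ofLp 2 _ _).fst

theorem continuous_graph_snd {Ω : Set Plane} : Continuous fun w : Graph Ω => w.snd :=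
  (WithLp.prod_continuous_ofLp 2 _ _).snd

/-- Korn's inequality with zero boundary values. -/
theorem norm_snd_sq_le_symPartLp {Ω : Set Plane} {w : Graph Ω} (hw : w ∈ H10 Ω) :
    ‖w.snd‖ ^ 2 ≤ 2 * ‖symPartLp Ω w.snd‖ ^ 2 := by
  refine mem_H10_of_forall_testGraph (p := fun w => ‖w.snd‖ ^ 2 ≤ 2 * ‖symPartLp Ω w.snd‖ ^ 2)
    (isClosed_le (continuous_graph_snd.norm.pow 2)
      ((((symPartLp Ω).continuous.comp continuous_graph_snd).norm.pow 2).const_mul 2)) ?_ hw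
  rintro w ⟨v, hv, -, h2⟩
  have hA : ‖w.snd‖ ^ 2 = ∫ x in Ω, ‖grad v x‖ ^ 2 := by
    rw [norm_sq_Lp_eq_integral]
    refine integral_congr_ae ?_
    filter_upwards [h2] with x hx
    rw [hx]
  have hB : ‖symPartLp Ω w.snd‖ ^ 2 = ∫ x in Ω, ‖symPart (grad v x)‖ ^ 2 := by
    rw [norm_sq_Lp_eq_integral]
    refine integral_congr_ae ?_
    filter_upwards [h2, coeFn_symPartLp w.snd] with x hx hx'
    rw [hx', hx]
  rw [hA, hB]
  exact integral_norm_grad_sq_le hv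

/-! ### Divergence theorem -/

theorem plane_eq_sum_single (e : Plane) :
    e = e 0 • EuclideanSpace.single 0 1 + e 1 • EuclideanSpace.single 1 1 := by
  ext i
  fin_cases i <;> simp

theorem clm_apply_eq_sum (L : Plane →L[ℝ] ℝ) (e : Plane) :
    L e = ∑ i, L (EuclideanSpace.single i 1) * e i := by
  conv_lhs => rw [plane_eq_sum_single e]
  simp [mul_comm]

theorem integral_fderiv_apply_test {Ω : Set Plane} {v : Plane → Plane} (hv : IsTestField Ω v)
    {ζ : Plane → ℝ} (hζ : ContDiff ℝ ∞ ζ) (hc : HasCompactSupport ζ) :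
    ∫ x in Ω, fderiv ℝ ζ x (v x) = -∫ x in Ω, ζ x * ∑ i, grad v x (i, i) := by
  have hv1 := fun i => contDiff_apply_of_isTestField hv i
  rw [setIntegral_eq_integral_of_forall_compl_eq_zero,
    setIntegral_eq_integral_of_forall_compl_eq_zero]
  · simp only [fun x => clm_apply_eq_sum (fderiv ℝ ζ x) (v x), Finset.mul_sum]
    rw [integral_finsetSum, integral_finsetSum, ← Finset.sum_neg_distrib]
    · refine Finset.sum_congr rfl fun i _ => ?_
      simp only [grad_apply hv.1]
      rw [integral_mul_fderiv_eq_neg hζ (hv1 i) hc, neg_neg]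
    · intro i _
      exact (hζ.continuous.mul (continuous_grad_apply hv.1 (i, i))).integrable_of_hasCompactSupport
        hc.mul_right
    · intro i _
      exact (((hζ.continuous_fderiv (by simp)).clm_apply continuous_const).mul
        (hv1 i).continuous).integrable_of_hasCompactSupport
        (hasCompactSupport_apply_of_isTestField hv i).mul_left
  · intro x hx
    simp [grad_eq_zero_of_notMem hv hx]
  · intro x hx
    simp [image_eq_zero_of_notMem_tsupport fun h => hx (hv.2.2 h)]

/-- The divergence theorem for fields in `H¹₀`. -/
theorem integral_fderiv_fst_eq_neg {Ω : Set Plane} {w : Graph Ω} (hw : w ∈ H10 Ω) {ζ : Plane → ℝ}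
    (hζ : ContDiff ℝ ∞ ζ) (hc : HasCompactSupport ζ) :
    ∫ x in Ω, fderiv ℝ ζ x (w.fst x) = -∫ x in Ω, ζ x * ∑ i, w.snd x (i, i) := by
  have dc : Continuous (fderiv ℝ ζ) := hζ.continuous_fderiv (by simp)
  let G : Plane → Plane := fun x => WithLp.toLp 2 fun i => fderiv ℝ ζ x (EuclideanSpace.single i 1)
  -- Pairing with `ζ` times the identity matrix extracts `ζ ∇ · w`. Both sides thereby become `L²`
  -- inner products, continuous in the `H¹` norm.
  let I : Plane → Mat2 := fun x => ζ x • WithLp.toLp 2 fun p => if p.1 = p.2 then 1 else 0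
  have hGc : Continuous G := (PiLp.continuous_toLp 2 _).comp (continuous_pi fun p => by fun_prop)
  have hIc : Continuous I := hζ.continuous.smul continuous_const
  have hG : MemLp G 2 (volume.restrict Ω) := hGc.memLp_of_hasCompactSupport
    ((hc.fderiv ℝ).comp_left (g := fun L : Plane →L[ℝ] ℝ =>
      (WithLp.toLp 2 fun i => L (EuclideanSpace.single i 1) : Plane)) (by ext; simp))
  have hI : MemLp I 2 (volume.restrict Ω) := hIc.memLp_of_hasCompactSupport hc.smul_right
  have eG : ∀ w : Graph Ω, inner ℝ (hG.toLp G) w.fst = ∫ x in Ω, fderiv ℝ ζ x (w.fst x) := by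
    intro w
    rw [L2.inner_def]
    refine integral_congr_ae ?_
    filter_upwards [hG.coeFn_toLp] with x hx
    rw [hx, clm_apply_eq_sum]
    simp [G, PiLp.inner_apply, mul_comm]
  have eI : ∀ w : Graph Ω, inner ℝ (hI.toLp I) w.snd = ∫ x in Ω, ζ x * ∑ i, w.snd x (i, i) := by
    intro w
    rw [L2.inner_def]
    refine integral_congr_ae ?_
    filter_upwards [hI.coeFn_toLp] with x hx
    rw [hx, inner_smul_left]
    simp [PiLp.inner_apply, Fintype.sum_prod_type]
  rw [← eG, ← eI]
  refine mem_H10_of_forall_testGraph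
    (p := fun w => inner ℝ (hG.toLp G) w.fst = -inner ℝ (hI.toLp I) w.snd)
    (isClosed_eq (continuous_const.inner continuous_graph_fst)
      (continuous_const.inner continuous_graph_snd).neg) ?_ hw
  rintro w ⟨v, hv, h1, h2⟩
  rw [eG, eI]
  refine Eq.trans (integral_congr_ae ?_) ((integral_fderiv_apply_test hv hζ hc).trans
    (congrArg Neg.neg (integral_congr_ae ?_)))
  · filter_upwards [h1] with x hx
    rw [hx]
  · filter_upwards [h2] with x hx
    rw [hx]

/-! ### The convective form -/

/-- The trilinear expression `∑ a_j A_ij b_i`. -/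
def tri (a : Plane) (A : Mat2) (b : Plane) : ℝ := ∑ i, (∑ j, a j * A (i, j)) * b i

theorem abs_tri_le (a : Plane) (A : Mat2) (b : Plane) : |tri a A b| ≤ ‖a‖ * ‖A‖ * ‖b‖ := by
  set P : Mat2 := WithLp.toLp 2 fun p => a p.2 * b p.1 with hP
  have h1 : tri a A b = inner ℝ A P := by
    simp [tri, hP, PiLp.inner_apply, Fintype.sum_prod_type]
    ring
  have h2 : ‖P‖ = ‖a‖ * ‖b‖ := by
    rw [← sq_eq_sq₀ (norm_nonneg _) (by positivity), mul_pow, EuclideanSpace.norm_sq_eq,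
      EuclideanSpace.norm_sq_eq, EuclideanSpace.norm_sq_eq, Fintype.sum_prod_type]
    simp only [hP, Fin.sum_univ_two, Real.norm_eq_abs, sq_abs]
    ring
  rw [h1]
  refine (abs_real_inner_le_norm _ _).trans (le_of_eq ?_)
  rw [h2]
  ring

theorem continuous_tri : Continuous fun p : Plane × Mat2 × Plane => tri p.1 p.2.1 p.2.2 := by
  unfold tri
  fun_prop

variable {Ω : Set Plane}

/-- `∫_Ω (u · ∇)v · w` for pairs of a field and its gradient. -/
def conv (u v w : Graph Ω) : ℝ := ∫ x in Ω, tri (u.fst x) (v.snd x) (w.fst x)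

theorem convection_eq_conv (u v w : V Ω) :
    convection u v w = conv (u : Graph Ω) (v : Graph Ω) (w : Graph Ω) := rfl

/-- Hölder with exponents `4, 2, 4`. Together with Ladyzhenskaya it makes the form finite and
continuous on `H10 Ω`. -/
theorem lintegral_tri_le (u v w : Graph Ω) :
    ∫⁻ x in Ω, ‖tri (u.fst x) (v.snd x) (w.fst x)‖ₑ ≤
      eLpNorm u.fst 4 (volume.restrict Ω) * ‖v.snd‖ₑ * eLpNorm w.fst 4 (volume.restrict Ω) := by
  have : ENNReal.HolderTriple 4 4 2 := ⟨by
    rw [← two_mul, show (4 : ENNReal) = 2 * 2 by norm_num, ENNReal.mul_inv (by simp) (by simp),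
      ← mul_assoc, ENNReal.mul_inv_cancel (by simp) (by simp), one_mul]⟩
  have mu := (Lp.aestronglyMeasurable u.fst).norm
  have mw := (Lp.aestronglyMeasurable w.fst).norm
  calc ∫⁻ x in Ω, ‖tri (u.fst x) (v.snd x) (w.fst x)‖ₑ
      ≤ ∫⁻ x in Ω, ‖v.snd x‖ₑ * ‖(‖u.fst x‖ • ‖w.fst x‖ : ℝ)‖ₑ := by
        refine lintegral_mono fun x => ?_
        simp only [smul_eq_mul, enorm_mul, enorm_norm]
        rw [← ofReal_norm (tri _ _ _), ← ofReal_norm, ← ofReal_norm, ← ofReal_norm,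
          ← ENNReal.ofReal_mul (norm_nonneg _), ← ENNReal.ofReal_mul (norm_nonneg _)]
        refine ENNReal.ofReal_le_ofReal ((abs_tri_le _ _ _).trans (le_of_eq (by ring)))
    _ ≤ eLpNorm v.snd 2 (volume.restrict Ω) *
          eLpNorm (fun x => (‖u.fst x‖ • ‖w.fst x‖ : ℝ)) 2 (volume.restrict Ω) :=
        lintegral_enorm_mul_le (Lp.aestronglyMeasurable _) (mu.smul mw)
    _ ≤ ‖v.snd‖ₑ * (eLpNorm u.fst 4 (volume.restrict Ω) * eLpNorm w.fst 4 (volume.restrict Ω)) := by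
        rw [Lp.enorm_def]
        gcongr
        have := eLpNorm_smul_le_mul_eLpNorm (p := 4) (q := 4) (r := 2) mw mu
        rw [eLpNorm_norm, eLpNorm_norm] at this
        exact this
    _ = _ := by ring

theorem eLpNorm_four_ne_top {w : Graph Ω} (hw : w ∈ H10 Ω) :
    eLpNorm w.fst 4 (volume.restrict Ω) ≠ ⊤ := by
  have h := (eLpNorm_four_sq_le hw).trans_lt
    (ENNReal.mul_lt_top ENNReal.coe_lt_top (ENNReal.mul_lt_top enorm_lt_top enorm_lt_top))
  intro h'
  simp [h'] at h

theorem integrable_tri {u w : Graph Ω} (hu : u ∈ H10 Ω) (v : Graph Ω) (hw : w ∈ H10 Ω) :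
    Integrable (fun x => tri (u.fst x) (v.snd x) (w.fst x)) (volume.restrict Ω) := by
  have h : AEStronglyMeasurable (fun x => (u.fst x, v.snd x, w.fst x)) (volume.restrict Ω) :=
    (Lp.aestronglyMeasurable u.fst).prodMk
      ((Lp.aestronglyMeasurable v.snd).prodMk (Lp.aestronglyMeasurable w.fst))
  have h' : HasFiniteIntegral (fun x => tri (u.fst x) (v.snd x) (w.fst x))
      (volume.restrict Ω) := by
    rw [hasFiniteIntegral_iff_enorm]
    exact (lintegral_tri_le u v w).trans_lt (ENNReal.mul_lt_top (ENNReal.mul_lt_top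
      (eLpNorm_four_ne_top hu).lt_top enorm_lt_top) (eLpNorm_four_ne_top hw).lt_top)
  have h'' : AEStronglyMeasurable (fun x => tri (u.fst x) (v.snd x) (w.fst x))
      (volume.restrict Ω) := by
    have h2 := continuous_tri.comp_aestronglyMeasurable h
    exact h2
  exact ⟨h'', h'⟩

theorem eLpNorm_four_toReal_sq_le {w : Graph Ω} (hw : w ∈ H10 Ω) :
    (eLpNorm w.fst 4 (volume.restrict Ω)).toReal ^ 2 ≤
      ladyzhenskayaConstFour * (‖w.fst‖ * ‖w.snd‖) := by
  have h := ENNReal.toReal_mono (ENNReal.mul_lt_top ENNReal.coe_lt_top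
    (ENNReal.mul_lt_top enorm_lt_top enorm_lt_top)).ne (eLpNorm_four_sq_le hw)
  simpa using h

theorem abs_conv_le {u w : Graph Ω} (hu : u ∈ H10 Ω) (v : Graph Ω) (hw : w ∈ H10 Ω) :
    |conv u v w| ≤ (eLpNorm u.fst 4 (volume.restrict Ω)).toReal * ‖v.snd‖ *
      (eLpNorm w.fst 4 (volume.restrict Ω)).toReal := by
  have h := ENNReal.toReal_mono (ENNReal.mul_lt_top (ENNReal.mul_lt_top
    (eLpNorm_four_ne_top hu).lt_top enorm_lt_top) (eLpNorm_four_ne_top hw).lt_top).ne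
    ((enorm_integral_le_lintegral_enorm _).trans (lintegral_tri_le u v w))
  simpa [conv] using h

theorem norm_graph_fst_le (w : Graph Ω) : ‖w.fst‖ ≤ ‖w‖ := by
  have := WithLp.prod_norm_sq_eq_of_L2 w
  nlinarith [sq_nonneg ‖w.snd‖, norm_nonneg w, norm_nonneg w.fst]

theorem norm_graph_snd_le (w : Graph Ω) : ‖w.snd‖ ≤ ‖w‖ := by
  have := WithLp.prod_norm_sq_eq_of_L2 w
  nlinarith [sq_nonneg ‖w.fst‖, norm_nonneg w, norm_nonneg w.snd]

theorem abs_conv_le_norm {u w : Graph Ω} (hu : u ∈ H10 Ω) (v : Graph Ω) (hw : w ∈ H10 Ω) :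
    |conv u v w| ≤ ladyzhenskayaConstFour * ‖u‖ * ‖v‖ * ‖w‖ := by
  set K := (ladyzhenskayaConstFour : ℝ) with hK
  have hK0 : 0 ≤ K := NNReal.coe_nonneg _
  have h1 : ∀ {w : Graph Ω}, w ∈ H10 Ω →
      (eLpNorm w.fst 4 (volume.restrict Ω)).toReal ≤ Real.sqrt K * ‖w‖ := by
    intro w hw
    refine (sq_le_sq₀ ENNReal.toReal_nonneg (by positivity)).1 ?_
    rw [mul_pow, Real.sq_sqrt hK0]
    refine (eLpNorm_four_toReal_sq_le hw).trans ?_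
    rw [sq]
    gcongr
    · exact norm_graph_fst_le w
    · exact norm_graph_snd_le w
  refine (abs_conv_le hu v hw).trans ?_
  calc _ ≤ (Real.sqrt K * ‖u‖) * ‖v‖ * (Real.sqrt K * ‖w‖) := by
        gcongr
        · exact h1 hu
        · exact norm_graph_snd_le v
        · exact h1 hw
    _ = (Real.sqrt K * Real.sqrt K) * ‖u‖ * ‖v‖ * ‖w‖ := by ring
    _ = _ := by rw [Real.mul_self_sqrt hK0]

theorem conv_add_left {u u' w : Graph Ω} (hu : u ∈ H10 Ω) (hu' : u' ∈ H10 Ω) (v : Graph Ω)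
    (hw : w ∈ H10 Ω) : conv (u + u') v w = conv u v w + conv u' v w := by
  unfold conv
  rw [← integral_add (integrable_tri hu v hw) (integrable_tri hu' v hw)]
  refine integral_congr_ae ?_
  filter_upwards [Lp.coeFn_add u.fst u'.fst] with x hx
  rw [WithLp.add_fst, hx]
  simp [tri]
  ring

theorem conv_add_middle {u w : Graph Ω} (hu : u ∈ H10 Ω) (v v' : Graph Ω)
    (hw : w ∈ H10 Ω) : conv u (v + v') w = conv u v w + conv u v' w := by
  unfold conv
  rw [← integral_add (integrable_tri hu v hw) (integrable_tri hu v' hw)]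
  refine integral_congr_ae ?_
  filter_upwards [Lp.coeFn_add v.snd v'.snd] with x hx
  rw [WithLp.add_snd, hx]
  simp [tri]
  ring

theorem conv_add_right {u w w' : Graph Ω} (hu : u ∈ H10 Ω) (v : Graph Ω)
    (hw : w ∈ H10 Ω) (hw' : w' ∈ H10 Ω) : conv u v (w + w') = conv u v w + conv u v w' := by
  unfold conv
  rw [← integral_add (integrable_tri hu v hw) (integrable_tri hu v hw')]
  refine integral_congr_ae ?_
  filter_upwards [Lp.coeFn_add w.fst w'.fst] with x hx
  rw [WithLp.add_fst, hx]
  simp [tri]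
  ring

theorem conv_smul_left (c : ℝ) (u v w : Graph Ω) : conv (c • u) v w = c * conv u v w := by
  unfold conv
  rw [← integral_const_mul]
  refine integral_congr_ae ?_
  filter_upwards [Lp.coeFn_smul c u.fst] with x hx
  rw [WithLp.smul_fst, hx]
  simp [tri]
  ring

theorem conv_smul_middle (c : ℝ) (u v w : Graph Ω) : conv u (c • v) w = c * conv u v w := by
  unfold conv
  rw [← integral_const_mul]
  refine integral_congr_ae ?_
  filter_upwards [Lp.coeFn_smul c v.snd] with x hx
  rw [WithLp.smul_snd, hx]
  simp [tri]
  ring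

theorem conv_smul_right (c : ℝ) (u v w : Graph Ω) : conv u v (c • w) = c * conv u v w := by
  unfold conv
  rw [← integral_const_mul]
  refine integral_congr_ae ?_
  filter_upwards [Lp.coeFn_smul c w.fst] with x hx
  rw [WithLp.smul_fst, hx]
  simp [tri]
  ring

/-- A bounded trilinear form is continuous. -/
theorem continuous_of_trilinear {E : Type*} [NormedAddCommGroup E] [NormedSpace ℝ E]
    (b : E → E → E → ℝ) (C : ℝ) (hC : 0 ≤ C)
    (h1 : ∀ u u' v w, b (u + u') v w = b u v w + b u' v w)
    (h2 : ∀ (c : ℝ) u v w, b (c • u) v w = c * b u v w)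
    (h3 : ∀ u v v' w, b u (v + v') w = b u v w + b u v' w)
    (h4 : ∀ (c : ℝ) u v w, b u (c • v) w = c * b u v w)
    (h5 : ∀ u v w w', b u v (w + w') = b u v w + b u v w')
    (h6 : ∀ (c : ℝ) u v w, b u v (c • w) = c * b u v w)
    (h7 : ∀ u v w, |b u v w| ≤ C * ‖u‖ * ‖v‖ * ‖w‖) :
    Continuous fun p : E × E × E => b p.1 p.2.1 p.2.2 := by
  let B₂ : E → E →L[ℝ] E →L[ℝ] ℝ := fun u =>
    LinearMap.mkContinuous₂ (LinearMap.mk₂ ℝ (b u) (h3 u) (fun c => h4 c u) (h5 u)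
      (fun c => h6 c u)) (C * ‖u‖) (h7 u)
  let B₁ : E →ₗ[ℝ] E →L[ℝ] E →L[ℝ] ℝ :=
    { toFun := B₂
      map_add' := fun u u' => by
        ext v w
        exact h1 u u' v w
      map_smul' := fun c u => by
        ext v w
        exact h2 c u v w }
  have hB : ∀ u, ‖B₁ u‖ ≤ C * ‖u‖ := fun u =>
    LinearMap.mkContinuous₂_norm_le _ (mul_nonneg hC (norm_nonneg u)) (h7 u)
  have hB' : Continuous B₁ := AddMonoidHomClass.continuous_of_bound B₁ C hB
  have h8 : Continuous fun p : E × E × E => B₁ p.1 := hB'.comp continuous_fst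
  have h9 : Continuous fun p : E × E × E => B₁ p.1 p.2.1 :=
    h8.clm_apply (continuous_fst.comp continuous_snd)
  exact h9.clm_apply (continuous_snd.comp continuous_snd)

theorem continuous_conv (Ω : Set Plane) : Continuous fun p : H10 Ω × H10 Ω × H10 Ω =>
    conv (p.1 : Graph Ω) (p.2.1 : Graph Ω) (p.2.2 : Graph Ω) :=
  continuous_of_trilinear (fun u v w : H10 Ω => conv (u : Graph Ω) (v : Graph Ω) (w : Graph Ω))
    ladyzhenskayaConstFour (NNReal.coe_nonneg _)
    (fun u u' _ w => conv_add_left u.2 u'.2 _ w.2) (fun c _ _ _ => conv_smul_left c _ _ _)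
    (fun u _ _ w => conv_add_middle u.2 _ _ w.2) (fun c _ _ _ => conv_smul_middle c _ _ _)
    (fun u _ w w' => conv_add_right u.2 _ w.2 w'.2) (fun c _ _ _ => conv_smul_right c _ _ _)
    (fun u _ w => abs_conv_le_norm u.2 _ w.2)

theorem testGraph_le_H10 : testGraph Ω ≤ H10 Ω := Submodule.le_topologicalClosure _

/-- Since `(u · ∇)ϕ · ϕ = ½ u · ∇|ϕ|²`, this is the divergence theorem for `u` with the scalar test
function `|ϕ|²`. -/
theorem conv_self_eq_zero_of_test {u v : Graph Ω} (hu : u ∈ V Ω) (hv : v ∈ testGraph Ω) :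
    conv u v v = 0 := by
  obtain ⟨ϕ, ⟨p1, p2, p3⟩, h1, h2⟩ := hv
  have hq : ContDiff ℝ ∞ (fun x => ‖ϕ x‖ ^ 2) := p1.norm_sq ℝ
  have hqc : HasCompactSupport (fun x => ‖ϕ x‖ ^ 2) :=
    p2.comp_left (g := fun y : Plane => ‖y‖ ^ 2) (by simp)
  have h := integral_fderiv_fst_eq_neg hu.1 hq hqc
  rw [integral_eq_zero_of_ae (f := fun x => ‖ϕ x‖ ^ 2 * ∑ i, u.snd x (i, i)), neg_zero] at h
  · have e : ∫ x in Ω, fderiv ℝ (fun x => ‖ϕ x‖ ^ 2) x (u.fst x) = 2 * conv u v v := by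
      unfold conv
      rw [← integral_const_mul]
      refine integral_congr_ae ?_
      filter_upwards [h1, h2] with x hx1 hx2
      rw [(p1.differentiable (by simp) x).hasFDerivAt.norm_sq.fderiv, hx1, hx2]
      generalize u.fst x = e
      have : ∀ i, fderiv ℝ ϕ x e i = ∑ j, e j * grad ϕ x (i, j) := by
        intro i
        conv_lhs => rw [plane_eq_sum_single e]
        simp [grad]
      simp [tri, PiLp.inner_apply, this]
      ring
    rw [e] at h
    linarith
  · filter_upwards [hu.2] with x hx
    simp [hx]

theorem conv_self_eq_zero {u v : Graph Ω} (hu : u ∈ V Ω) (hv : v ∈ H10 Ω) : conv u v v = 0 := by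
  obtain ⟨a, ha, hlim⟩ := mem_closure_iff_seq_limit.1 (show v ∈ closure (testGraph Ω : Set _) from hv)
  let a' : ℕ → H10 Ω := fun n => ⟨a n, testGraph_le_H10 (ha n)⟩
  have hlim' : Tendsto a' atTop (𝓝 ⟨v, hv⟩) := tendsto_subtype_rng.2 hlim
  have hpair : Continuous fun w : H10 Ω => ((⟨u, hu.1⟩ : H10 Ω), w, w) := by fun_prop
  have hc : Continuous fun w : H10 Ω => conv u (w : Graph Ω) (w : Graph Ω) := by
    have h := (continuous_conv Ω).comp hpair
    exact h
  have h1 := (hc.tendsto ⟨v, hv⟩).comp hlim'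
  refine tendsto_nhds_unique h1 (tendsto_const_nhds.congr fun n => ?_)
  exact (conv_self_eq_zero_of_test hu (ha n)).symm

/-! ### Monotonicity of the Bingham law -/

/-- The plastic part `S - 2μD` is a subgradient of `τy |·|` at `D`. This form treats the yielded and
rigid cases alike, so monotonicity needs no case distinction on the two strains. -/
theorem BinghamLaw.inner_self_and_le {μ τy : ℝ} (hτy : 0 ≤ τy) {D S : Mat2}
    (h : BinghamLaw μ τy D S) :
    inner ℝ (S - (2 * μ) • D) D = τy * ‖D‖ ∧ ∀ E : Mat2, inner ℝ (S - (2 * μ) • D) E ≤ τy * ‖E‖ := by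
  by_cases hD : D = 0
  · subst hD
    refine ⟨by simp, fun E => ?_⟩
    rw [smul_zero, sub_zero]
    exact (real_inner_le_norm _ _).trans
      (mul_le_mul_of_nonneg_right (h.2 rfl) (norm_nonneg _))
  · have hn : ‖D‖ ≠ 0 := norm_ne_zero_iff.2 hD
    have e : S - (2 * μ) • D = (τy / ‖D‖) • D := by
      rw [h.1 hD, add_smul, add_sub_cancel_left]
    rw [e]
    constructor
    · rw [real_inner_smul_left, real_inner_self_eq_norm_sq]
      field_simp
    · intro E
      refine (real_inner_le_norm _ _).trans (le_of_eq ?_)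
      rw [norm_smul, Real.norm_of_nonneg (by positivity)]
      field_simp

/-- The Bingham law is strongly monotone. -/
theorem BinghamLaw.le_inner_sub {μ τy : ℝ} (hτy : 0 ≤ τy) {D₁ S₁ D₂ S₂ : Mat2}
    (h₁ : BinghamLaw μ τy D₁ S₁) (h₂ : BinghamLaw μ τy D₂ S₂) :
    2 * μ * ‖D₁ - D₂‖ ^ 2 ≤ inner ℝ (S₁ - S₂) (D₁ - D₂) := by
  obtain ⟨a1, b1⟩ := h₁.inner_self_and_le hτy
  obtain ⟨a2, b2⟩ := h₂.inner_self_and_le hτy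
  have e : S₁ - S₂ = (2 * μ) • (D₁ - D₂) + ((S₁ - (2 * μ) • D₁) - (S₂ - (2 * μ) • D₂)) := by
    module
  rw [e, inner_add_left, real_inner_smul_left, real_inner_self_eq_norm_sq, inner_sub_left,
    inner_sub_right, inner_sub_right, a1, a2]
  linarith [b1 D₂, b2 D₁]

/-! ### Stress and convection estimates at a fixed time -/

/-- `field` as a continuous linear map. -/
def fieldL (Ω : Set Plane) : V Ω →L[ℝ] L2Vec Ω :=
  (WithLp.fstL 2 ℝ (L2Vec Ω) (L2Mat Ω)).comp (V Ω).subtypeL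

/-- `weakGrad` as a continuous linear map. -/
def weakGradL (Ω : Set Plane) : V Ω →L[ℝ] L2Mat Ω :=
  (WithLp.sndL 2 ℝ (L2Vec Ω) (L2Mat Ω)).comp (V Ω).subtypeL

/-- The strain tensor as a continuous linear map. -/
def strainL (Ω : Set Plane) : V Ω →L[ℝ] L2Mat Ω := (symPartLp Ω).comp (weakGradL Ω)

theorem fieldL_apply (w : V Ω) : fieldL Ω w = field w := rfl

theorem coeFn_strainL (w : V Ω) : strainL Ω w =ᵐ[volume.restrict Ω] strain w :=
  coeFn_symPartLp (weakGrad w)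

theorem integral_inner_strain (S : L2Mat Ω) (w : V Ω) :
    ∫ x in Ω, inner ℝ (S x) (strain w x) = inner ℝ S (strainL Ω w) := by
  rw [L2.inner_def]
  refine integral_congr_ae ?_
  filter_upwards [coeFn_strainL w] with x hx
  rw [hx]

theorem norm_weakGrad_sq_le (w : V Ω) : ‖weakGrad w‖ ^ 2 ≤ 2 * ‖strainL Ω w‖ ^ 2 :=
  norm_snd_sq_le_symPartLp w.2.1

theorem le_inner_stress_sub {μ τy : ℝ} (hμ : 0 < μ) (hτy : 0 ≤ τy) {u₁ u₂ : V Ω} {S₁ S₂ : L2Mat Ω}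
    (h₁ : ∀ᵐ x ∂volume.restrict Ω, BinghamLaw μ τy (strain u₁ x) (S₁ x))
    (h₂ : ∀ᵐ x ∂volume.restrict Ω, BinghamLaw μ τy (strain u₂ x) (S₂ x)) :
    μ * ‖weakGrad (u₁ - u₂)‖ ^ 2 ≤ inner ℝ (S₁ - S₂) (strainL Ω (u₁ - u₂)) := by
  have h : 2 * μ * ‖strainL Ω (u₁ - u₂)‖ ^ 2 ≤ inner ℝ (S₁ - S₂) (strainL Ω (u₁ - u₂)) := by
    rw [norm_sq_Lp_eq_integral, L2.inner_def, ← integral_const_mul]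
    refine integral_mono_ae ?_ (L2.integrable_inner _ _) ?_
    · exact ((Lp.memLp (strainL Ω (u₁ - u₂))).integrable_norm_pow (p := 2) (by simp)).const_mul _
    · have e : strainL Ω (u₁ - u₂) = strainL Ω u₁ - strainL Ω u₂ := map_sub _ _ _
      filter_upwards [h₁, h₂, coeFn_strainL u₁, coeFn_strainL u₂,
        Lp.coeFn_sub (strainL Ω u₁) (strainL Ω u₂), Lp.coeFn_sub S₁ S₂] with x l1 l2 e1 e2 e3 e4
      rw [e, e3, e4, Pi.sub_apply, Pi.sub_apply, e1, e2]
      exact l1.le_inner_sub hτy l2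
  have := norm_weakGrad_sq_le (u₁ - u₂)
  nlinarith

/-- Expanding with `u₁ = u₂ + w` leaves the extra term `∫ (u₂ · ∇)w · w`, which vanishes. -/
theorem convection_sub_eq (u₁ u₂ : V Ω) :
    convection u₁ u₁ (u₁ - u₂) - convection u₂ u₂ (u₁ - u₂) =
      convection (u₁ - u₂) u₁ (u₁ - u₂) := by
  obtain ⟨w, rfl⟩ : ∃ w, u₁ = u₂ + w := ⟨u₁ - u₂, by abel⟩
  rw [add_sub_cancel_left]
  simp only [convection_eq_conv, Submodule.coe_add]
  rw [conv_add_left u₂.2.1 w.2.1 _ w.2.1, conv_add_middle u₂.2.1 _ _ w.2.1,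
    conv_self_eq_zero u₂.2 w.2.1]
  ring

theorem abs_convection_self_le (w u : V Ω) :
    |convection w u w| ≤ ladyzhenskayaConstFour * (‖field w‖ * ‖weakGrad w‖) * ‖weakGrad u‖ := by
  refine (abs_conv_le w.2.1 (u : Graph Ω) w.2.1).trans ?_
  calc _ = (eLpNorm (w : Graph Ω).fst 4 (volume.restrict Ω)).toReal ^ 2 * ‖weakGrad u‖ := by
        rw [weakGrad]
        ring
    _ ≤ _ := mul_le_mul_of_nonneg_right (eLpNorm_four_toReal_sq_le w.2.1) (norm_nonneg _)

theorem aestronglyMeasurable_convection {α : Type*} [MeasurableSpace α] {ν : Measure α}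
    {u v w : α → V Ω} (hu : AEStronglyMeasurable u ν) (hv : AEStronglyMeasurable v ν)
    (hw : AEStronglyMeasurable w ν) :
    AEStronglyMeasurable (fun t => convection (u t) (v t) (w t)) ν := by
  have hι : Continuous fun u : V Ω => (⟨u, u.2.1⟩ : H10 Ω) :=
    Continuous.subtype_mk continuous_subtype_val _
  have hc : Continuous fun p : V Ω × V Ω × V Ω => convection p.1 p.2.1 p.2.2 := by
    have h := (continuous_conv Ω).comp (hι.prodMap (hι.prodMap hι))
    exact h
  have := hc.comp_aestronglyMeasurable (hu.prodMk (hv.prodMk hw))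
  exact this

theorem abs_convection_le_norm (u v w : V Ω) :
    |convection u v w| ≤ ladyzhenskayaConstFour * ‖u‖ * ‖v‖ * ‖w‖ :=
  abs_conv_le_norm u.2.1 _ w.2.1

/-! ### Localization of the weak formulation in time -/

variable {T μ τy : ℝ} {f : ℝ → VDual Ω} {u₀ : H Ω} {u : ℝ → V Ω} {τ : ℝ → L2Mat Ω}

/-- Supplies the countable dense family of test vectors on which the energy identity relies. -/
instance : SecondCountableTopology (V Ω) := by
  have : Fact ((2 : ENNReal) ≠ ⊤) := ⟨by simp⟩
  have h1 : SecondCountableTopology (L2Vec Ω) := inferInstance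
  have h2 : SecondCountableTopology (L2Mat Ω) := inferInstance
  have h3 : SecondCountableTopology (Graph Ω) := WithLp.secondCountableTopology 2 _ _
  exact TopologicalSpace.Subtype.secondCountableTopology _

theorem ae_add_add_eq_of_setIntegral {α : Type*} [MeasurableSpace α] {ν : Measure α}
    {a b c d : α → ℝ} (ha : Integrable a ν) (hb : Integrable b ν) (hc : Integrable c ν)
    (hd : Integrable d ν) (h : ∀ A, MeasurableSet A →
      (∫ t in A, a t ∂ν) + (∫ t in A, b t ∂ν) + (∫ t in A, c t ∂ν) = ∫ t in A, d t ∂ν) :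
    ∀ᵐ t ∂ν, a t + b t + c t = d t := by
  refine ((ha.add hb).add hc).ae_eq_of_forall_setIntegral_eq _ _ hd fun A hA _ => ?_
  rw [← h A hA]
  exact (integral_add (ha.add hb).restrict hc.restrict).trans
    (congrArg (· + _) (integral_add ha.restrict hb.restrict))

/-- The weak formulation localizes in time: for a test function `w` it holds at almost every time.
The test functions used are multiples of `w` by `(1 + ‖u‖²)⁻¹` and indicator functions, so that the
convective term is integrable in time. -/
theorem weak_form_ae {S : ℝ → L2Mat Ω} {g : ℝ → VDual Ω} (hf : MemLp f 2 (timeMeasure T))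
    (hu : MemLp u 2 (timeMeasure T)) (hS : MemLp S 2 (timeMeasure T))
    (hg : MemLp g 2 (timeMeasure T))
    (h : ∀ φ : ℝ → V Ω, MemLp φ 2 (timeMeasure T) →
      (∫ t in Ioo 0 T, g t (φ t))
        + (∫ t in Ioo 0 T, ∫ x in Ω, inner ℝ (S t x) (strain (φ t) x))
        + (∫ t in Ioo 0 T, convection (u t) (u t) (φ t))
        = ∫ t in Ioo 0 T, f t (φ t))
    {w : ℝ → V Ω} (hw : MemLp w 2 (timeMeasure T)) :
    ∀ᵐ t ∂timeMeasure T,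
      g t (w t) + inner ℝ (S t) (strainL Ω (w t)) + convection (u t) (u t) (w t) = f t (w t) := by
  set m : ℝ → ℝ := fun t => (1 + ‖u t‖ ^ 2)⁻¹ with hm
  have hm0 : ∀ t, 0 < m t := fun t => by positivity
  have hm1 : ∀ t, ‖m t‖ ≤ 1 := fun t => by
    rw [Real.norm_of_nonneg (hm0 t).le]
    exact inv_le_one_of_one_le₀ (by nlinarith [sq_nonneg ‖u t‖])
  have hcm : Continuous fun x : V Ω => (1 + ‖x‖ ^ 2)⁻¹ :=
    Continuous.inv₀ (by fun_prop) fun x => by positivity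
  have hmm : AEStronglyMeasurable m (timeMeasure T) :=
    hcm.comp_aestronglyMeasurable hu.1
  have hm1' : ∀ᵐ t ∂timeMeasure T, ‖m t‖ ≤ 1 := Eventually.of_forall hm1
  have i1 : Integrable (fun t => m t * g t (w t)) (timeMeasure T) :=
    (integrable_apply hg hw).bdd_mul hmm hm1'
  have i2 : Integrable (fun t => m t * inner ℝ (S t) (strainL Ω (w t))) (timeMeasure T) := by
    have hs : MemLp (fun t => strainL Ω (w t)) 2 (timeMeasure T) := (strainL Ω).comp_memLp' hw
    have : Integrable (fun t => inner ℝ (S t) (strainL Ω (w t))) (timeMeasure T) :=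
      (hS.norm.integrable_mul hs.norm).mono' (hS.1.inner hs.1)
        (Eventually.of_forall fun t => norm_inner_le_norm _ _)
    exact this.bdd_mul hmm hm1'
  have i3 : Integrable (fun t => m t * convection (u t) (u t) (w t)) (timeMeasure T) := by
    refine ((hw.integrable (by simp)).norm.const_mul (ladyzhenskayaConstFour : ℝ)).mono'
      (hmm.mul (aestronglyMeasurable_convection hu.1 hu.1 hw.1)) (Eventually.of_forall fun t => ?_)
    rw [norm_mul, Real.norm_of_nonneg (hm0 t).le, Real.norm_eq_abs]
    have h1 := abs_convection_le_norm (u t) (u t) (w t)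
    have h2 : m t * ‖u t‖ ^ 2 ≤ 1 := by
      rw [hm]
      simp only
      rw [inv_mul_le_one₀ (by positivity)]
      linarith
    have h3 : 0 ≤ (ladyzhenskayaConstFour : ℝ) * ‖w t‖ := by positivity
    calc m t * |convection (u t) (u t) (w t)|
        ≤ m t * (ladyzhenskayaConstFour * ‖u t‖ * ‖u t‖ * ‖w t‖) :=
          mul_le_mul_of_nonneg_left h1 (hm0 t).le
      _ = (m t * ‖u t‖ ^ 2) * (ladyzhenskayaConstFour * ‖w t‖) := by ring
      _ ≤ 1 * (ladyzhenskayaConstFour * ‖w t‖) := mul_le_mul_of_nonneg_right h2 h3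
      _ = _ := one_mul _
  have i4 : Integrable (fun t => m t * f t (w t)) (timeMeasure T) :=
    (integrable_apply hf hw).bdd_mul hmm hm1'
  have key := ae_add_add_eq_of_setIntegral i1 i2 i3 i4 ?_
  · filter_upwards [key] with t ht
    rw [← mul_add, ← mul_add] at ht
    exact mul_left_cancel₀ (hm0 t).ne' ht
  · intro A hA
    have hφ : MemLp (A.indicator fun t => m t • w t) 2 (timeMeasure T) := by
      refine MemLp.indicator hA (hw.mono (hmm.smul hw.1) (Eventually.of_forall fun t => ?_))
      rw [norm_smul]
      exact mul_le_of_le_one_left (norm_nonneg _) (hm1 t)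
    have e := h _ hφ
    have ind : ∀ (F : ℝ → V Ω → ℝ), (∀ t, F t 0 = 0) → (∀ t (c : ℝ) v, F t (c • v) = c * F t v) →
        ∫ t in Ioo 0 T, F t (A.indicator (fun t => m t • w t) t) =
          ∫ t in A, m t * F t (w t) ∂timeMeasure T := by
      intro F F0 F1
      rw [← integral_indicator hA]
      refine integral_congr_ae (Eventually.of_forall fun t => ?_)
      by_cases ht : t ∈ A <;> simp [ht, F0, F1]
    simp only [integral_inner_strain] at e
    rw [ind (fun t v => g t v) (by simp) (by simp),
      ind (fun t v => inner ℝ (S t) (strainL Ω v)) (by simp) (by simp [inner_smul_right]),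
      ind (fun t v => convection (u t) (u t) v) ?_ ?_,
      ind (fun t v => f t v) (by simp) (by simp)] at e
    · exact e
    · intro t
      have := conv_smul_right (0 : ℝ) (u t : Graph Ω) (u t : Graph Ω) (0 : Graph Ω)
      rw [zero_mul, smul_zero] at this
      exact this
    · intro t c v
      exact conv_smul_right c (u t : Graph Ω) (u t : Graph Ω) (v : Graph Ω)

/-! ### The energy method -/

/-- Intervals to the right of `a` have positive measure. Limits along the filter of the initial
condition are therefore unique. -/
theorem nhdsGT_inf_ae_neBot (a : ℝ) : (𝓝[>] a ⊓ ae (volume : Measure ℝ)).NeBot := by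
  rw [inf_neBot_iff]
  intro s hs s' hs'
  obtain ⟨b, hb, hbs⟩ := mem_nhdsGT_iff_exists_Ioo_subset.1 hs
  by_contra hne
  rw [not_nonempty_iff_eq_empty] at hne
  have hsub : Ioo a b ⊆ s'ᶜ := fun x hx hx' => by
    have : x ∈ s ∩ s' := ⟨hbs hx, hx'⟩
    simp [hne] at this
  have h0 : volume (Ioo a b) = 0 := measure_mono_null hsub hs'
  rw [Real.volume_Ioo, ENNReal.ofReal_eq_zero] at h0
  linarith [mem_Ioi.1 hb]

/-- Young's inequality, to be used with `a = ‖w‖`, `b = ‖∇w‖` and `c = ‖∇u₁‖`. Of the dissipation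
`2μb²` one half absorbs the convective term and the other half is kept. -/
theorem two_mul_residual_le {μ a b c K G P Q : ℝ} (hμ : 0 < μ) (hQ : |Q| ≤ K * (a * b) * c)
    (hP : μ * b ^ 2 ≤ P) (hG : G + P + Q = 0) :
    2 * G ≤ K ^ 2 / μ * c ^ 2 * a ^ 2 - μ * b ^ 2 := by
  have h1 : 2 * (K * (a * b) * c) ≤ K ^ 2 / μ * c ^ 2 * a ^ 2 + μ * b ^ 2 := by
    have : K ^ 2 / μ * c ^ 2 * a ^ 2 + μ * b ^ 2 - 2 * (K * (a * b) * c) =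
        (K * c * a - μ * b) ^ 2 / μ := by
      field_simp
      ring
    have := div_nonneg (sq_nonneg (K * c * a - μ * b)) hμ.le
    linarith
  linarith [neg_abs_le Q]

/-- A function that tends to zero at the initial time and differs from a primitive by a constant
is that primitive. -/
theorem eq_zero_of_sub_primitive_eq_const (hT : 0 < T) {y k : ℝ → ℝ} (ik : IntegrableOn k (Ioo 0 T))
    {c : ℝ} (hc : ∀ᵐ t ∂timeMeasure T, y t - ∫ r in (0 : ℝ)..t, k r = c)
    (hy : Tendsto y (𝓝[>] (0 : ℝ) ⊓ ae volume) (𝓝 0)) : c = 0 := by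
  have hne := nhdsGT_inf_ae_neBot 0
  have t2 : Tendsto (fun t => ∫ r in (0 : ℝ)..t, k r) (𝓝[>] (0 : ℝ) ⊓ ae volume) (𝓝 0) := by
    have hcont := intervalIntegral.continuousOn_primitive_interval'
      (intervalIntegrable_of_integrableOn_Ioo ik (left_mem_Icc.2 hT.le) (right_mem_Icc.2 hT.le))
      left_mem_uIcc 0 left_mem_uIcc
    have hle : 𝓝[>] (0 : ℝ) ≤ 𝓝[uIcc 0 T] 0 := by
      rw [← nhdsWithin_Ioo_eq_nhdsGT hT, uIcc_of_le hT.le]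
      exact nhdsWithin_mono _ Ioo_subset_Icc_self
    have := hcont.mono_left (inf_le_left.trans hle : 𝓝[>] (0 : ℝ) ⊓ ae volume ≤ _)
    simpa using this
  have t3 := hy.sub t2
  rw [sub_zero] at t3
  refine tendsto_nhds_unique (tendsto_const_nhds.congr' ?_) t3
  have a1 : ∀ᶠ t in 𝓝[>] (0 : ℝ) ⊓ ae volume, t ∈ Ioo 0 T :=
    Filter.Eventually.filter_mono inf_le_left (Ioo_mem_nhdsGT hT)
  have a2 : ∀ᶠ t in 𝓝[>] (0 : ℝ) ⊓ ae volume, t ∈ Ioo 0 T →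
      y t - ∫ r in (0 : ℝ)..t, k r = c :=
    ((ae_restrict_iff' measurableSet_Ioo).1 hc).filter_mono inf_le_right
  filter_upwards [a1, a2] with t h1 h2 using (h2 h1).symm

/-- A nonnegative absolutely continuous function with zero initial value and
`y' ≤ a y - d`, where `d ≥ 0`, vanishes together with `d`. -/
theorem ae_eq_zero_of_primitive_le (hT : 0 < T) {y k a d : ℝ → ℝ}
    (ia : IntegrableOn a (Ioo 0 T)) (ik : IntegrableOn k (Ioo 0 T)) (ha : ∀ t, 0 ≤ a t)
    (hd : ∀ t, 0 ≤ d t) (hy : ∀ t, 0 ≤ y t)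
    (hyk : ∀ᵐ t ∂timeMeasure T, y t = ∫ r in (0 : ℝ)..t, k r)
    (hk : ∀ᵐ t ∂timeMeasure T, k t ≤ a t * y t - d t) :
    ∀ᵐ t ∂timeMeasure T, y t = 0 ∧ d t = 0 := by
  have hle := primitive_nonpos_of_le_mul hT ia ha ik (by
    filter_upwards [hk, hyk] with t h1 h2
    rw [← h2]
    linarith [hd t])
  have hY0 : ∀ᵐ t ∂timeMeasure T, y t = 0 ∧ ∫ r in (0 : ℝ)..t, k r = 0 := by
    filter_upwards [hyk, ae_restrict_mem measurableSet_Ioo] with t h1 h2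
    have h3 := hle t (Ioo_subset_Icc_self h2)
    have h4 := hy t
    constructor <;> linarith
  filter_upwards [hY0, ae_eq_zero_of_primitive_ae_eq_zero hT ik (hY0.mono fun t h => h.2), hk]
    with t h1 h2 h3
  rw [h2, h1.1, mul_zero] at h3
  exact ⟨h1.1, by linarith [hd t]⟩

section Energy

variable {E F : Type*} [NormedAddCommGroup E] [NormedSpace ℝ E] [NormedAddCommGroup F]
  [InnerProductSpace ℝ F]

theorem weak_deriv_sub (j : E →L[ℝ] F) {u₁ u₂ : ℝ → E} {g₁ g₂ : ℝ → StrongDual ℝ E}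
    (mu₁ : MemLp u₁ 2 (timeMeasure T)) (mu₂ : MemLp u₂ 2 (timeMeasure T))
    (hg₁ : MemLp g₁ 2 (timeMeasure T)) (hg₂ : MemLp g₂ 2 (timeMeasure T)) {ψ : ℝ → ℝ} {v : E}
    (p1 : ContDiff ℝ ∞ ψ) (p2 : HasCompactSupport ψ)
    (h₁ : ∫ t in Ioo 0 T, deriv ψ t * inner ℝ (j (u₁ t)) (j v) = -∫ t in Ioo 0 T, ψ t * g₁ t v)
    (h₂ : ∫ t in Ioo 0 T, deriv ψ t * inner ℝ (j (u₂ t)) (j v) = -∫ t in Ioo 0 T, ψ t * g₂ t v) :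
    ∫ t in Ioo 0 T, deriv ψ t * inner ℝ (j (u₁ t - u₂ t)) (j v) =
      -∫ t in Ioo 0 T, ψ t * (g₁ t - g₂ t) v := by
  obtain ⟨C, hC⟩ := p1.continuous.bounded_above_of_compact_support p2
  obtain ⟨C', hC'⟩ := (p1.continuous_deriv (by simp)).bounded_above_of_compact_support p2.deriv
  have hm : AEStronglyMeasurable ψ (timeMeasure T) := p1.continuous.aestronglyMeasurable
  have hm' : AEStronglyMeasurable (deriv ψ) (timeMeasure T) :=
    (p1.continuous_deriv (by simp)).aestronglyMeasurable
  have ij : ∀ {u : ℝ → E}, MemLp u 2 (timeMeasure T) →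
      Integrable (fun t => deriv ψ t * inner ℝ (j (u t)) (j v)) (timeMeasure T) := fun hu =>
    ((j.integrable_comp (hu.integrable (by simp))).inner_const (j v)).bdd_mul hm'
      (Eventually.of_forall hC')
  have ig : ∀ {g : ℝ → StrongDual ℝ E}, MemLp g 2 (timeMeasure T) →
      Integrable (fun t => ψ t * g t v) (timeMeasure T) := fun hg =>
    ((ContinuousLinearMap.apply ℝ ℝ v).integrable_comp (hg.integrable (by simp))).bdd_mul hm
      (Eventually.of_forall hC)
  simp only [map_sub, sub_apply, inner_sub_left, mul_sub]
  rw [integral_sub (ij mu₁) (ij mu₂), integral_sub (ig hg₁) (ig hg₂), h₁, h₂]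
  ring

/-- The energy method: two functions with the same initial value coincide if their difference
satisfies a Grönwall type energy inequality. -/
theorem ae_eq_zero_of_energy_le [SecondCountableTopology E] (hT : 0 < T) (j : E →L[ℝ] F)
    {u₁ u₂ : ℝ → E} {g₁ g₂ : ℝ → StrongDual ℝ E}
    (mu₁ : MemLp u₁ 2 (timeMeasure T)) (mu₂ : MemLp u₂ 2 (timeMeasure T))
    (hg₁ : MemLp g₁ 2 (timeMeasure T)) (hg₂ : MemLp g₂ 2 (timeMeasure T))
    (h₁ : ∀ ψ : ℝ → ℝ, ContDiff ℝ ∞ ψ → HasCompactSupport ψ → tsupport ψ ⊆ Ioo 0 T → ∀ v : E,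
      ∫ t in Ioo 0 T, deriv ψ t * inner ℝ (j (u₁ t)) (j v) = -∫ t in Ioo 0 T, ψ t * g₁ t v)
    (h₂ : ∀ ψ : ℝ → ℝ, ContDiff ℝ ∞ ψ → HasCompactSupport ψ → tsupport ψ ⊆ Ioo 0 T → ∀ v : E,
      ∫ t in Ioo 0 T, deriv ψ t * inner ℝ (j (u₂ t)) (j v) = -∫ t in Ioo 0 T, ψ t * g₂ t v)
    {z : F} (t₁ : Tendsto (fun t => j (u₁ t)) (𝓝[>] (0 : ℝ) ⊓ ae volume) (𝓝 z))
    (t₂ : Tendsto (fun t => j (u₂ t)) (𝓝[>] (0 : ℝ) ⊓ ae volume) (𝓝 z))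
    {a d : ℝ → ℝ} (ia : IntegrableOn a (Ioo 0 T)) (ha : ∀ t, 0 ≤ a t) (hd : ∀ t, 0 ≤ d t)
    (hest : ∀ᵐ t ∂timeMeasure T,
      2 * (g₁ t - g₂ t) (u₁ t - u₂ t) ≤ a t * ‖j (u₁ t - u₂ t)‖ ^ 2 - d t) :
    ∀ᵐ t ∂timeMeasure T, ‖j (u₁ t - u₂ t)‖ ^ 2 = 0 ∧ d t = 0 := by
  have mw : MemLp (fun t => u₁ t - u₂ t) 2 (timeMeasure T) := mu₁.sub mu₂
  have mg : MemLp (fun t => g₁ t - g₂ t) 2 (timeMeasure T) := hg₁.sub hg₂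
  obtain ⟨c, hc⟩ := ae_norm_sq_sub_integral_eq_const hT j mw mg fun ψ p1 p2 p3 v =>
    weak_deriv_sub j mu₁ mu₂ hg₁ hg₂ p1 p2 (h₁ ψ p1 p2 p3 v) (h₂ ψ p1 p2 p3 v)
  have ik : IntegrableOn (fun t => 2 * (g₁ t - g₂ t) (u₁ t - u₂ t)) (Ioo 0 T) :=
    (integrable_apply mg mw).const_mul 2
  simp only [← intervalIntegral.integral_const_mul] at hc
  have t0 : Tendsto (fun t => ‖j (u₁ t - u₂ t)‖ ^ 2) (𝓝[>] (0 : ℝ) ⊓ ae volume) (𝓝 0) := by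
    have := ((t₁.sub t₂).norm).pow 2
    rw [sub_self, norm_zero, zero_pow two_ne_zero] at this
    simpa only [map_sub] using this
  have hc0 := eq_zero_of_sub_primitive_eq_const hT ik hc t0
  exact ae_eq_zero_of_primitive_le hT ia ik ha hd (fun t => by positivity)
    (hc.mono fun t h => sub_eq_zero.1 (h.trans hc0)) hest

end Energy

/-! ### Uniqueness of the velocity and of the stress -/

theorem eq_zero_of_field_weakGrad {w : V Ω} (h1 : field w = 0) (h2 : weakGrad w = 0) : w = 0 :=
  Subtype.ext (WithLp.ofLp_injective 2 (Prod.ext h1 h2))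

/-- The differential inequality for the energy of the difference of two solutions. -/
theorem energy_difference_le {v₁ v₂ : V Ω} {S₁ S₂ : L2Mat Ω} {g₁ g₂ F : VDual Ω} (hμ : 0 < μ)
    (hτy : 0 ≤ τy)
    (e₁ : g₁ (v₁ - v₂) + inner ℝ S₁ (strainL Ω (v₁ - v₂)) + convection v₁ v₁ (v₁ - v₂) =
      F (v₁ - v₂))
    (e₂ : g₂ (v₁ - v₂) + inner ℝ S₂ (strainL Ω (v₁ - v₂)) + convection v₂ v₂ (v₁ - v₂) =
      F (v₁ - v₂))
    (l₁ : ∀ᵐ x ∂volume.restrict Ω, BinghamLaw μ τy (strain v₁ x) (S₁ x))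
    (l₂ : ∀ᵐ x ∂volume.restrict Ω, BinghamLaw μ τy (strain v₂ x) (S₂ x)) :
    2 * (g₁ - g₂) (v₁ - v₂) ≤ (ladyzhenskayaConstFour : ℝ) ^ 2 / μ * ‖weakGrad v₁‖ ^ 2 *
      ‖field (v₁ - v₂)‖ ^ 2 - μ * ‖weakGrad (v₁ - v₂)‖ ^ 2 := by
  refine two_mul_residual_le hμ (abs_convection_self_le (v₁ - v₂) v₁)
    (le_inner_stress_sub hμ hτy l₁ l₂) ?_
  have e3 := convection_sub_eq v₁ v₂
  rw [inner_sub_left, sub_apply]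
  linarith

theorem velocity_unique {u₁ u₂ : ℝ → V Ω} {τ₁ τ₂ : ℝ → L2Mat Ω} (hT : 0 < T) (hμ : 0 < μ)
    (hτy : 0 ≤ τy) (hf : MemLp f 2 (timeMeasure T)) (h₁ : IsWeakSolution Ω T μ τy f u₀ u₁ τ₁)
    (h₂ : IsWeakSolution Ω T μ τy f u₀ u₂ τ₂) : ∀ᵐ t ∂timeMeasure T, u₁ t = u₂ t := by
  obtain ⟨g₁, hg₁, hd₁, hw₁⟩ := h₁.weak_form
  obtain ⟨g₂, hg₂, hd₂, hw₂⟩ := h₂.weak_form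
  have mu₁ := h₁.memLp_velocity
  have mu₂ := h₂.memLp_velocity
  have mw : MemLp (fun t => u₁ t - u₂ t) 2 (timeMeasure T) := mu₁.sub mu₂
  have ia : IntegrableOn (fun t => (ladyzhenskayaConstFour : ℝ) ^ 2 / μ * ‖weakGrad (u₁ t)‖ ^ 2)
      (Ioo 0 T) := by
    have h := ((weakGradL Ω).comp_memLp' mu₁).integrable_norm_pow (p := 2) (by simp)
    exact h.const_mul _
  have hest : ∀ᵐ t ∂timeMeasure T, 2 * (g₁ t - g₂ t) (u₁ t - u₂ t) ≤
      (ladyzhenskayaConstFour : ℝ) ^ 2 / μ * ‖weakGrad (u₁ t)‖ ^ 2 * ‖field (u₁ t - u₂ t)‖ ^ 2 -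
        μ * ‖weakGrad (u₁ t - u₂ t)‖ ^ 2 := by
    filter_upwards [weak_form_ae hf mu₁ h₁.memLp_stress hg₁ hw₁ mw,
      weak_form_ae hf mu₂ h₂.memLp_stress hg₂ hw₂ mw, h₁.law, h₂.law] with t e1 e2 l1 l2
    exact energy_difference_le hμ hτy e1 e2 l1 l2
  have key := ae_eq_zero_of_energy_le hT (fieldL Ω) mu₁ mu₂ hg₁ hg₂ hd₁ hd₂ h₁.initial h₂.initial ia
    (fun t => by positivity) (fun t => by positivity) hest
  filter_upwards [key] with t ht
  -- An element of `V` is a pair. The energy kills the field and the retained dissipation kills the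
  -- gradient, so uniqueness of weak gradients is not needed.
  refine sub_eq_zero.1 (eq_zero_of_field_weakGrad ?_ ?_)
  · simpa [fieldL_apply] using ht.1
  · simpa [hμ.ne'] using ht.2

end Bingham

end

theorem mainTheorem3 (Ω : Set Bingham.Plane) (hΩ : IsOpen Ω) (T μ τy : ℝ)
    (hT : 0 < T) (hμ : 0 < μ) (hτy : 0 ≤ τy)
    (f : ℝ → Bingham.VDual Ω) (hf : MemLp f 2 (Bingham.timeMeasure T)) (u₀ : Bingham.H Ω)
    (u₁ u₂ : ℝ → Bingham.V Ω) (τ₁ τ₂ : ℝ → Bingham.L2Mat Ω)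
    (h₁ : Bingham.IsWeakSolution Ω T μ τy f u₀ u₁ τ₁)
    (h₂ : Bingham.IsWeakSolution Ω T μ τy f u₀ u₂ τ₂) :
    (∀ᵐ t ∂(Bingham.timeMeasure T), u₁ t = u₂ t) ∧
      ∀ᵐ t ∂(Bingham.timeMeasure T), ∀ᵐ x ∂(volume.restrict Ω),
        Bingham.strain (u₁ t) x ≠ 0 → τ₁ t x = τ₂ t x := by
  have h := Bingham.velocity_unique hT hμ hτy hf h₁ h₂
  refine ⟨h, ?_⟩
  filter_upwards [h, h₁.law, h₂.law] with t ht l1 l2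
  filter_upwards [l1, l2] with x m1 m2 hx
  -- Where the common strain is nonzero the law determines the stress.
  rw [m1.1 hx, m2.1 (ht ▸ hx), ht]
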